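/- Let $p$ be an odd prime such that the class of $2$ generates the unit group $U(\mathbb Z_{p^2})$, and let $G=\langle a\rangle\times\langle b\rangle$ be an abelian group (internal direct product) with $o(a)=p^2$ and $o(b)=p$. For a subgroup $H\le G$ let $\widehat H=\frac1{|H|}\sum_{h\in H}h\in\mathbb F_2G$, and for $x\in G$ let $\widehat x=\widehat{\langle x\rangle}$. A minimal code is a minimal nonzero ideal of $\mathbb F_2G$; two ideals are $G$-equivalent if the linear extension to $\mathbb F_2 G$ of some automorphism of $G$ maps one onto the other; the weight of a code is the least number of nonzero coefficients of a nonzero element of it. Then: (1) $\mathbb F_2G$ has exactly four $G$-equivalence classes of minimal codes, and the ideals generated by $$e_0=\widehat G,\quad e_1=\widehat b-\widehat{\langle a^p\rangle\times\langle b\rangle},\quad e_2=\widehat a-\widehat G,\quad e_3=\widehat{\langle a^p\rangle\times\langle b\rangle}-\widehat G$$ are minimal codes, pairwise not $G$-equivalent, that represent these four classes. (2) Put $e_{1j}=\widehat{a^{jp}b}-\widehat{\langle a^p\rangle\times\langle b\rangle}$ and $e_{2i}=\widehat{ab^i}-\widehat G$ for $0\le i,j\le p-1$ (so $e_{10}=e_1$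 and $e_{20}=e_2$). The $2p+2$ elements $e_0$, $e_{1j}$, $e_{2i}$, $e_3$ are primitive idempotents, the ideals they generate are pairwise distinct, and these are all the minimal codes of $\mathbb F_2G$. Their dimensions over $\mathbb F_2$ and their weights are: - $\mathbb F_2G\,e_0$: dimension $1$, weight $p^3$; - $\mathbb F_2G\,e_{1j}$ ($0\le j\le p-1$): dimension $p^2-p$, weight $2p$; - $\mathbb F_2G\,e_{2i}$ ($0\le i\le p-1$): dimension $p-1$, weight $2p^2$; - $\mathbb F_2G\,e_3$: dimension $p-1$, weight $2p^2$. (3) $G$ is a finite group of odd order and exponent $p^2$, and $p^2$ has $\tau(p^2)=3\ne4$ divisors. So $G$ is a counterexample to the assertion (Miller's "Theorem A") that for every finite abelian group $G$ of odd order and exponent $n$ there are precisely $\tau(n)$ $G$-equivalence classes of minimal codes in $\mathbb F_2G$, where $\tau(n)$ is the number of divisors of $n$; in particular that assertion is false. -/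

import Mathlib

/-!
Abelian codes: ideals of the group algebra `F G` (Mathlib's `MonoidAlgebra F G`) of an abelian
group `G` over a field `F`.
-/

noncomputable section

namespace AbelianCode

variable {F : Type*} [Field F] {G : Type*} [CommGroup G]

/-- The element `Ĥ = |H|⁻¹ ∑_{h ∈ H} h` of `F G`, for a finite subgroup `H` of `G`. -/
def hat (F : Type*) [Field F] {G : Type*} [CommGroup G] (H : Subgroup G) : MonoidAlgebra F G :=
  (Nat.card H : F)⁻¹ • ∑ᶠ h : H, MonoidAlgebra.single (h : G) (1 : F)

/-- The code `F G · e` generated by `e`. -/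
def code (e : MonoidAlgebra F G) : Ideal (MonoidAlgebra F G) := Ideal.span {e}

/-- A primitive idempotent: a nonzero idempotent that is not the sum of two nonzero
orthogonal idempotents. -/
def IsPrimitiveIdempotent {R : Type*} [CommRing R] (e : R) : Prop :=
  IsIdempotentElem e ∧ e ≠ 0 ∧
    ∀ f g : R, IsIdempotentElem f → IsIdempotentElem g → f * g = 0 → e = f + g → f = 0 ∨ g = 0

/-- A minimal code: a minimal nonzero ideal of `F G`. -/
def IsMinimalCode (I : Ideal (MonoidAlgebra F G)) : Prop := IsAtom I

/-- `G`-equivalence of codes: the linear extension to `F G` of some automorphism of `G` maps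
`I` onto `J`. -/
def GEquivalent (I J : Ideal (MonoidAlgebra F G)) : Prop :=
  ∃ ψ : G ≃* G,
    (MonoidAlgebra.domCongr F F ψ : MonoidAlgebra F G → MonoidAlgebra F G) ''
      (I : Set (MonoidAlgebra F G)) = (J : Set (MonoidAlgebra F G))

theorem GEquivalent.refl (I : Ideal (MonoidAlgebra F G)) : GEquivalent I I := by
  refine ⟨MulEquiv.refl G, ?_⟩
  have h : ∀ x : MonoidAlgebra F G, MonoidAlgebra.domCongr F F (MulEquiv.refl G) x = x := by
    intro x
    ext g
    rw [MonoidAlgebra.coeff_domCongr]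
    rfl
  simp [h]

theorem GEquivalent.symm {I J : Ideal (MonoidAlgebra F G)} (h : GEquivalent I J) :
    GEquivalent J I := by
  obtain ⟨ψ, hψ⟩ := h
  refine ⟨ψ.symm, ?_⟩
  rw [← hψ, Set.image_image]
  have h : ∀ x : MonoidAlgebra F G,
      MonoidAlgebra.domCongr F F ψ.symm (MonoidAlgebra.domCongr F F ψ x) = x := by
    intro x
    ext g
    rw [MonoidAlgebra.coeff_domCongr, MonoidAlgebra.coeff_domCongr]
    simp
  simp [h]

theorem GEquivalent.trans {I J K : Ideal (MonoidAlgebra F G)} (h : GEquivalent I J)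
    (h' : GEquivalent J K) : GEquivalent I K := by
  obtain ⟨ψ, hψ⟩ := h
  obtain ⟨φ, hφ⟩ := h'
  refine ⟨ψ.trans φ, ?_⟩
  rw [← hφ, ← hψ, Set.image_image]
  have h : ∀ x : MonoidAlgebra F G,
      MonoidAlgebra.domCongr F F (ψ.trans φ) x =
        MonoidAlgebra.domCongr F F φ (MonoidAlgebra.domCongr F F ψ x) := by
    intro x
    ext g
    rw [MonoidAlgebra.coeff_domCongr, MonoidAlgebra.coeff_domCongr, MonoidAlgebra.coeff_domCongr]
    rfl
  simp [h]

/-- `G`-equivalence as an equivalence relation on the minimal codes of `F G`. -/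
def minimalCodeSetoid (F : Type*) [Field F] (G : Type*) [CommGroup G] :
    Setoid {I : Ideal (MonoidAlgebra F G) // IsMinimalCode I} where
  r I J := GEquivalent I.1 J.1
  iseqv := ⟨fun I => GEquivalent.refl I.1, fun h => h.symm, fun h h' => h.trans h'⟩

/-- The number of `G`-equivalence classes of minimal codes of `F G`. -/
def numMinimalClasses (F : Type*) [Field F] (G : Type*) [CommGroup G] : ℕ :=
  Nat.card (Quotient (minimalCodeSetoid F G))

/-- The dimension over `F` of a code. -/
def dim (I : Ideal (MonoidAlgebra F G)) : ℕ := Module.finrank F (I.restrictScalars F)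

/-- The Hamming weight of an element of `F G`: the number of its nonzero coefficients. -/
def elemWeight (x : MonoidAlgebra F G) : ℕ := x.coeff.support.card

/-- The weight of a (nonzero) code: the least weight of a nonzero element. -/
def weight (I : Ideal (MonoidAlgebra F G)) : ℕ :=
  sInf {n | ∃ x ∈ I, x ≠ 0 ∧ elemWeight x = n}

/-- The assertion claimed by Miller for a finite abelian group `G`: if `G` has odd order and
exponent `n`, then `𝔽₂ G` has precisely `τ(n)` classes of `G`-equivalent minimal codes, where
`τ(n)` is the number of divisors of `n`. -/
def MillerClaim (G : Type*) [CommGroup G] : Prop :=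
  Odd (Nat.card G) → numMinimalClasses (ZMod 2) G = (Monoid.exponent G).divisors.card

section Rows

variable (p : ℕ) (a b : G)

/-- `Ĝ`. -/
def e₀ (G : Type*) [CommGroup G] : MonoidAlgebra (ZMod 2) G := hat (ZMod 2) (⊤ : Subgroup G)

/-- The element `(a^{jp} b)^ - (⟨a^p⟩ × ⟨b⟩)^`; for `j = 0` it is `b̂ - (⟨a^p⟩ × ⟨b⟩)^`. -/
def e₁ (j : ℕ) : MonoidAlgebra (ZMod 2) G :=
  hat (ZMod 2) (Subgroup.zpowers (a ^ (j * p) * b)) -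
    hat (ZMod 2) (Subgroup.zpowers (a ^ p) ⊔ Subgroup.zpowers b)

/-- The element `(a b^i)^ - Ĝ`; for `i = 0` it is `â - Ĝ`. -/
def e₂ (i : ℕ) : MonoidAlgebra (ZMod 2) G :=
  hat (ZMod 2) (Subgroup.zpowers (a * b ^ i)) - hat (ZMod 2) (⊤ : Subgroup G)

/-- The element `(⟨a^p⟩ × ⟨b⟩)^ - Ĝ`. -/
def e₃ : MonoidAlgebra (ZMod 2) G :=
  hat (ZMod 2) (Subgroup.zpowers (a ^ p) ⊔ Subgroup.zpowers b) -
    hat (ZMod 2) (⊤ : Subgroup G)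

/-- The four representatives
`Ĝ`, `b̂ - (⟨a^p⟩ × ⟨b⟩)^`, `â - Ĝ`, `(⟨a^p⟩ × ⟨b⟩)^ - Ĝ`. -/
def rep : Fin 4 → MonoidAlgebra (ZMod 2) G :=
  ![hat (ZMod 2) (⊤ : Subgroup G),
    hat (ZMod 2) (Subgroup.zpowers b) -
      hat (ZMod 2) (Subgroup.zpowers (a ^ p) ⊔ Subgroup.zpowers b),
    hat (ZMod 2) (Subgroup.zpowers a) - hat (ZMod 2) (⊤ : Subgroup G),
    hat (ZMod 2) (Subgroup.zpowers (a ^ p) ⊔ Subgroup.zpowers b) -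
      hat (ZMod 2) (⊤ : Subgroup G)]

end Rows

end AbelianCode

end

/-! Since `|G| = p³` is odd, `𝔽₂G` is semisimple, so every ideal is generated by an idempotent and
minimal codes correspond to primitive idempotents. The proof bounds the number of idempotents from
above and exhibits enough orthogonal ones to meet the bound.

Upper bound: an idempotent is fixed by Frobenius, which acts on `𝔽₂G` by `g ↦ g²`, so its
coefficients are constant on orbits of squaring. As 2 generates the units mod `p²`, `x` and `x ^ w`
share an orbit whenever `p ∤ w`, and the elements `1`, `a^p`, `a^{jp}b`, `ab^i` meet every orbit
(`exists_eq_orbitRep_zpow`). The idempotents thus form an `𝔽₂`-space of dimension at most `2p + 2`.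

Lower bound: `hat_mul_hat` turns products of hats into joins of subgroups, and the joins show that
the `2p + 2` listed elements are nonzero orthogonal idempotents. They are therefore a basis of that
space, hence primitive, and they generate all minimal codes.

Dimensions and weights come from viewing the ideal of `Ĥ` as the functions constant on `H`-cosets.
Explicit automorphisms merge the `e₁ j` and merge the `e₂ i`. Weights separate the four classes
except `e₂` from `e₃`, where an automorphism would carry `⟨a⟩` onto a subgroup of exponent `p`. Four
classes against three divisors of `p²` refutes Miller's assertion. -/

noncomputable section

namespace AbelianCode

open MonoidAlgebra

/-! ### Idempotents attached to subgroups -/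

section Hat

variable {G : Type*} [CommGroup G]

theorem natCast_zmod_two_of_odd {n : ℕ} (h : Odd n) : (n : ZMod 2) = 1 :=
  ZMod.natCast_eq_one_iff_odd.2 h

theorem odd_card_subgroup (hG : Odd (Nat.card G)) (H : Subgroup G) : Odd (Nat.card H) :=
  hG.of_dvd_nat H.card_subgroup_dvd_card

theorem hat_eq_sum (hG : Odd (Nat.card G)) (H : Subgroup G) [Fintype H] :
    hat (ZMod 2) H = ∑ h : H, single (h : G) (1 : ZMod 2) := by
  rw [hat, natCast_zmod_two_of_odd (odd_card_subgroup hG H), inv_one, one_smul,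
    finsum_eq_sum_of_fintype]

variable [Finite G]

open Classical in
theorem coeff_hat (hG : Odd (Nat.card G)) (H : Subgroup G) (g : G) :
    (hat (ZMod 2) H).coeff g = if g ∈ H then 1 else 0 := by
  have := Fintype.ofFinite H
  rw [hat_eq_sum hG, coeff_sum, Finsupp.finsetSum_apply]
  simp only [coeff_single, Finsupp.single_apply]
  split_ifs with hg
  · rw [Finset.sum_eq_single ⟨g, hg⟩]
    · simp
    · intro b _ hb
      rw [if_neg]
      rintro rfl
      exact hb rfl
    · simp
  · refine Finset.sum_eq_zero fun x _ => if_neg ?_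
    rintro rfl
    exact hg x.2

theorem single_mul_hat (hG : Odd (Nat.card G)) {H : Subgroup G} {h : G} (hh : h ∈ H) :
    single h 1 * hat (ZMod 2) H = hat (ZMod 2) H := by
  classical
  ext g
  rw [coeff_single_mul_apply, coeff_hat hG, coeff_hat hG, one_mul,
    H.mul_mem_cancel_left (H.inv_mem hh)]

/-- Averaging: if `H` fixes `x`, then `Ĥ x` is a sum of `|H|` copies of `x`, and `|H|` is odd. -/
theorem hat_mul_eq_self_iff (hG : Odd (Nat.card G)) (H : Subgroup G)
    (x : MonoidAlgebra (ZMod 2) G) :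
    hat (ZMod 2) H * x = x ↔ ∀ h ∈ H, single h 1 * x = x := by
  constructor
  · intro hx h hh
    rw [← hx, ← mul_assoc, single_mul_hat hG hh]
  · intro hx
    have := Fintype.ofFinite H
    rw [hat_eq_sum hG, Finset.sum_mul, Finset.sum_congr rfl fun (h : H) _ => hx h h.2,
     Finset.sum_const,
      Finset.card_univ, ← Nat.card_eq_fintype_card, ← Nat.cast_smul_eq_nsmul (ZMod 2),
      natCast_zmod_two_of_odd (odd_card_subgroup hG H), one_smul]

theorem hat_mul_eq_self_iff_coeff (hG : Odd (Nat.card G)) (H : Subgroup G)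
    (x : MonoidAlgebra (ZMod 2) G) :
    hat (ZMod 2) H * x = x ↔ ∀ h ∈ H, ∀ g, x.coeff (h * g) = x.coeff g := by
  rw [hat_mul_eq_self_iff hG]
  constructor
  · intro hx h hh g
    have := congrArg (fun y => y.coeff g) (hx h⁻¹ (H.inv_mem hh))
    simpa only [coeff_single_mul_apply, one_mul, inv_inv] using this
  · intro hx h hh
    ext g
    rw [coeff_single_mul_apply, one_mul, hx _ (H.inv_mem hh)]

theorem hat_mul_hat_of_le (hG : Odd (Nat.card G)) {H K : Subgroup G} (h : H ≤ K) :
    hat (ZMod 2) H * hat (ZMod 2) K = hat (ZMod 2) K :=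
  (hat_mul_eq_self_iff hG _ _).2 fun _ hg => single_mul_hat hG (h hg)

/-- The product of the two hats is invariant under `H` and `K`, hence under their join, whose hat
absorbs both factors. All orthogonality relations thereby reduce to joins of subgroups. -/
theorem hat_mul_hat (hG : Odd (Nat.card G)) (H K : Subgroup G) :
    hat (ZMod 2) H * hat (ZMod 2) K = hat (ZMod 2) (H ⊔ K) := by
  have key : hat (ZMod 2) (H ⊔ K) * (hat (ZMod 2) H * hat (ZMod 2) K) =
      hat (ZMod 2) H * hat (ZMod 2) K := by
    rw [hat_mul_eq_self_iff hG]
    intro g hg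
    obtain ⟨h, hh, k, hk, rfl⟩ := Subgroup.mem_sup.1 hg
    have : (single (h * k) 1 : MonoidAlgebra (ZMod 2) G) = single h 1 * single k 1 := by
      rw [single_mul_single, one_mul]
    rw [this, mul_mul_mul_comm, single_mul_hat hG hh, single_mul_hat hG hk]
  rw [← key, mul_comm, mul_assoc, hat_mul_hat_of_le hG le_sup_right, hat_mul_hat_of_le hG le_sup_left]

theorem isIdempotentElem_hat (hG : Odd (Nat.card G)) (H : Subgroup G) :
    IsIdempotentElem (hat (ZMod 2) H) := by
  rw [IsIdempotentElem, hat_mul_hat hG, sup_idem]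

theorem hat_injective (hG : Odd (Nat.card G)) :
    Function.Injective (hat (ZMod 2) : Subgroup G → MonoidAlgebra (ZMod 2) G) := by
  classical
  intro H K h
  ext g
  have := congrArg (fun x => x.coeff g) h
  simp only [coeff_hat hG] at this
  split_ifs at this <;> simp_all

theorem hat_ne_zero (hG : Odd (Nat.card G)) (H : Subgroup G) : hat (ZMod 2) H ≠ 0 := by
  classical
  intro h
  have := congrArg (fun x => x.coeff 1) h
  simp [coeff_hat hG, H.one_mem] at this

theorem isIdempotentElem_hat_sub_hat (hG : Odd (Nat.card G)) {H K : Subgroup G} (h : H ≤ K) :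
    IsIdempotentElem (hat (ZMod 2) H - hat (ZMod 2) K) := by
  rw [IsIdempotentElem, sub_mul, mul_sub, mul_sub, isIdempotentElem_hat hG, isIdempotentElem_hat hG,
    hat_mul_hat_of_le hG h, mul_comm, hat_mul_hat_of_le hG h, sub_self, sub_zero]

end Hat

/-! ### Dimension and weight of the ideals of `Ĥ` and `Ĥ - K̂` -/

section Code

theorem mem_span_singleton_iff_of_isIdempotentElem {R : Type*} [CommRing R] {e x : R}
    (he : IsIdempotentElem e) : x ∈ Ideal.span {e} ↔ e * x = x := by
  rw [Ideal.mem_span_singleton']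
  constructor
  · rintro ⟨a, rfl⟩
    rw [mul_left_comm, he]
  · intro h
    exact ⟨x, by rw [mul_comm, h]⟩

theorem eq_of_span_singleton_eq_of_isIdempotentElem {R : Type*} [CommRing R] {e f : R}
    (he : IsIdempotentElem e) (hf : IsIdempotentElem f)
    (h : Ideal.span {e} = Ideal.span {f}) : e = f := by
  have h1 : e * f = f := (mem_span_singleton_iff_of_isIdempotentElem he).1
    (h ▸ Ideal.mem_span_singleton_self f)
  have h2 : f * e = e := (mem_span_singleton_iff_of_isIdempotentElem hf).1
    (h ▸ Ideal.mem_span_singleton_self e)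
  rw [← h2, mul_comm, h1]

variable {G : Type*} [CommGroup G]

theorem exists_coeff_ne_zero {x : MonoidAlgebra (ZMod 2) G} (hx : x ≠ 0) :
    ∃ g, x.coeff g ≠ 0 := by
  by_contra! h
  exact hx (by ext g; simp [h g])

theorem weight_eq_of_forall_le {I : Ideal (MonoidAlgebra (ZMod 2) G)} {n : ℕ}
    (hle : ∀ x ∈ I, x ≠ 0 → n ≤ elemWeight x) (hex : ∃ x ∈ I, x ≠ 0 ∧ elemWeight x = n) :
    weight I = n := by
  refine le_antisymm (Nat.sInf_le hex) (le_csInf ⟨n, hex⟩ ?_)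
  rintro m ⟨x, hx, hx0, rfl⟩
  exact hle x hx hx0

/-- The augmentation map `∑ x_g g ↦ ∑ x_g`. -/
def augmentation (G : Type*) [CommGroup G] : MonoidAlgebra (ZMod 2) G →ₐ[ZMod 2] ZMod 2 :=
  MonoidAlgebra.lift (ZMod 2) (ZMod 2) G 1

theorem augmentation_eq_elemWeight (x : MonoidAlgebra (ZMod 2) G) :
    augmentation G x = (elemWeight x : ZMod 2) := by
  rw [augmentation, MonoidAlgebra.lift_apply, elemWeight, Finset.card_eq_sum_ones, Nat.cast_sum,
    Finsupp.sum]
  refine Finset.sum_congr rfl fun g hg => ?_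
  rw [Finsupp.mem_support_iff] at hg
  have : ∀ z : ZMod 2, z ≠ 0 → z = 1 := by decide
  simp [this _ hg]

variable [Finite G]

theorem mem_code_hat_iff (hG : Odd (Nat.card G)) (H : Subgroup G)
    (x : MonoidAlgebra (ZMod 2) G) :
    x ∈ code (hat (ZMod 2) H) ↔ ∀ h ∈ H, ∀ g, x.coeff (h * g) = x.coeff g := by
  rw [code, mem_span_singleton_iff_of_isIdempotentElem (isIdempotentElem_hat hG H),
    hat_mul_eq_self_iff_coeff hG]

theorem code_hat_sub_hat_le (hG : Odd (Nat.card G)) {H K : Subgroup G} (h : H ≤ K) :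
    code (hat (ZMod 2) H - hat (ZMod 2) K) ≤ code (hat (ZMod 2) H) := by
  rw [code, code, Ideal.span_singleton_le_iff_mem,
    mem_span_singleton_iff_of_isIdempotentElem (isIdempotentElem_hat hG H), mul_sub,
    isIdempotentElem_hat hG, hat_mul_hat_of_le hG h]

/-- The ideal consists of the functions constant on cosets of `H`, that is, of the pullbacks of
functions on `G ⧸ H`. -/
theorem dim_code_hat (hG : Odd (Nat.card G)) (H : Subgroup G) :
    dim (code (hat (ZMod 2) H)) = H.index := by
  have := Fintype.ofFinite (G ⧸ H)
  let L : ((G ⧸ H) → ZMod 2) →ₗ[ZMod 2] MonoidAlgebra (ZMod 2) G :=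
    (coeffLinearEquiv (ZMod 2)).symm.toLinearMap ∘ₗ
      (Finsupp.linearEquivFunOnFinite (ZMod 2) (ZMod 2) G).symm.toLinearMap ∘ₗ
        LinearMap.funLeft (ZMod 2) (ZMod 2) (QuotientGroup.mk : G → G ⧸ H)
  have hL : ∀ φ g, (L φ).coeff g = φ (QuotientGroup.mk g) := fun φ g => rfl
  have hinj : Function.Injective L := by
    intro φ ψ h
    ext q
    obtain ⟨g, rfl⟩ := QuotientGroup.mk_surjective q
    rw [← hL φ, ← hL ψ, h]
  have hrange : (code (hat (ZMod 2) H)).restrictScalars (ZMod 2) = LinearMap.range L := by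
    ext x
    rw [Submodule.restrictScalars_mem, mem_code_hat_iff hG]
    constructor
    · intro hx
      refine ⟨fun q => Quotient.liftOn' q x.coeff fun g g' hgg => ?_, ?_⟩
      · rw [QuotientGroup.leftRel_apply] at hgg
        rw [← hx _ hgg g, mul_right_comm, inv_mul_cancel, one_mul]
      · ext g
        rw [hL]
        rfl
    · rintro ⟨φ, rfl⟩ h hh g
      rw [hL, hL]
      congr 1
      rw [QuotientGroup.eq, mul_inv_rev, mul_right_comm, inv_mul_cancel, one_mul]
      exact H.inv_mem hh
  rw [dim, hrange, LinearMap.finrank_range_of_inj hinj, Module.finrank_fintype_fun_eq_card,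
    ← Nat.card_eq_fintype_card, Subgroup.index]

/-- Orthogonality makes the ideal of `e + f` the direct sum of the other two, by `x = e x + f x`. -/
theorem dim_code_add {e f : MonoidAlgebra (ZMod 2) G} (he : IsIdempotentElem e)
    (hf : IsIdempotentElem f) (hef : e * f = 0) :
    dim (code (e + f)) = dim (code e) + dim (code f) := by
  have hadd : IsIdempotentElem (e + f) := by
    rw [IsIdempotentElem, add_mul, mul_add, mul_add, mul_comm f e, hef, he, hf, add_zero, zero_add]
  have hsup : (code (e + f)).restrictScalars (ZMod 2) =
      (code e).restrictScalars (ZMod 2) ⊔ (code f).restrictScalars (ZMod 2) := by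
    ext x
    simp only [Submodule.mem_sup, Submodule.restrictScalars_mem, code,
      mem_span_singleton_iff_of_isIdempotentElem, he, hf, hadd]
    constructor
    · intro hx
      refine ⟨e * x, ?_, f * x, ?_, ?_⟩
      · rw [← mul_assoc, he]
      · rw [← mul_assoc, hf]
      · rw [← add_mul, hx]
    · rintro ⟨y, hy, z, hz, rfl⟩
      have h1 : f * y = 0 := by rw [← hy, ← mul_assoc, mul_comm f, hef, zero_mul]
      have h2 : e * z = 0 := by rw [← hz, ← mul_assoc, hef, zero_mul]
      rw [add_mul, mul_add, mul_add, hy, hz, h1, h2, add_zero, zero_add]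
  have hinf : (code e).restrictScalars (ZMod 2) ⊓ (code f).restrictScalars (ZMod 2) = ⊥ := by
    rw [eq_bot_iff]
    rintro x ⟨hx, hy⟩
    have hx' := (mem_span_singleton_iff_of_isIdempotentElem he).1 hx
    have hy' := (mem_span_singleton_iff_of_isIdempotentElem hf).1 hy
    rw [Submodule.mem_bot, ← hx', ← hy', ← mul_assoc, hef, zero_mul]
  have : Module.Finite (ZMod 2) (MonoidAlgebra (ZMod 2) G) :=
    Module.Finite.of_basis (MonoidAlgebra.basis G (ZMod 2))
  have := Submodule.finrank_sup_add_finrank_inf_eq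
    ((code e).restrictScalars (ZMod 2)) ((code f).restrictScalars (ZMod 2))
  rw [hinf, finrank_bot, add_zero, ← hsup] at this
  exact this

theorem dim_code_hat_sub_hat (hG : Odd (Nat.card G)) {H K : Subgroup G} (h : H ≤ K) :
    dim (code (hat (ZMod 2) H - hat (ZMod 2) K)) = H.index - K.index := by
  have := dim_code_add (isIdempotentElem_hat_sub_hat hG h) (isIdempotentElem_hat hG K)
    (by rw [sub_mul, hat_mul_hat_of_le hG h, isIdempotentElem_hat hG, sub_self])
  rw [sub_add_cancel, dim_code_hat hG, dim_code_hat hG] at this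
  omega

/-- The set `s` is the coset `Hg`; its membership criterion serves to prove that different cosets
are disjoint. -/
theorem card_support_of_mem_code_hat (hG : Odd (Nat.card G)) {H : Subgroup G}
    {x : MonoidAlgebra (ZMod 2) G} (hx : x ∈ code (hat (ZMod 2) H)) {g : G}
    (hg : x.coeff g ≠ 0) :
    ∃ s ⊆ x.coeff.support, s.card = Nat.card H ∧ ∀ k, k ∈ s ↔ k * g⁻¹ ∈ H := by
  classical
  have := Fintype.ofFinite H
  refine ⟨Finset.univ.image fun h : H => (h : G) * g, ?_, ?_, ?_⟩
  · intro k hk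
    obtain ⟨h, -, rfl⟩ := Finset.mem_image.1 hk
    rw [Finsupp.mem_support_iff, (mem_code_hat_iff hG H x).1 hx h h.2]
    exact hg
  · rw [Finset.card_image_of_injective, Finset.card_univ, Nat.card_eq_fintype_card]
    intro h h' hh
    exact Subtype.ext (mul_right_cancel hh)
  · intro k
    rw [Finset.mem_image]
    constructor
    · rintro ⟨h, -, rfl⟩
      rw [mul_inv_cancel_right]
      exact h.2
    · intro hk
      exact ⟨⟨_, hk⟩, Finset.mem_univ _, inv_mul_cancel_right _ _⟩

theorem elemWeight_hat (hG : Odd (Nat.card G)) (H : Subgroup G) :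
    elemWeight (hat (ZMod 2) H) = Nat.card H := by
  classical
  have := Fintype.ofFinite G
  have : (hat (ZMod 2) H).coeff.support = Finset.univ.filter (· ∈ H) := by
    ext g
    simp [coeff_hat hG]
  rw [elemWeight, this, ← Fintype.card_subtype, Nat.card_eq_fintype_card]

theorem weight_code_hat (hG : Odd (Nat.card G)) (H : Subgroup G) :
    weight (code (hat (ZMod 2) H)) = Nat.card H := by
  refine weight_eq_of_forall_le ?_ ⟨_, Ideal.mem_span_singleton_self _, hat_ne_zero hG H,
    elemWeight_hat hG H⟩
  intro x hx hx0
  obtain ⟨g, hg⟩ := exists_coeff_ne_zero hx0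
  obtain ⟨s, hs, hsc, -⟩ := card_support_of_mem_code_hat hG hx hg
  rw [← hsc]
  exact Finset.card_le_card hs

theorem augmentation_hat (hG : Odd (Nat.card G)) (H : Subgroup G) :
    augmentation G (hat (ZMod 2) H) = 1 := by
  rw [augmentation_eq_elemWeight, elemWeight_hat hG,
    natCast_zmod_two_of_odd (odd_card_subgroup hG H)]

/-- Supports are unions of `H`-cosets, each of odd size, while the augmentation vanishes on the
ideal and forces even weight. So at least two cosets occur. -/
theorem weight_code_hat_sub_hat (hG : Odd (Nat.card G)) {H K : Subgroup G} (h : H < K) :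
    weight (code (hat (ZMod 2) H - hat (ZMod 2) K)) = 2 * Nat.card H := by
  classical
  refine weight_eq_of_forall_le ?_ ?_
  · intro x hx hx0
    have hxH := code_hat_sub_hat_le hG h.le hx
    obtain ⟨g, hg⟩ := exists_coeff_ne_zero hx0
    obtain ⟨s, hs, hsc, hsm⟩ := card_support_of_mem_code_hat hG hxH hg
    have heven : (elemWeight x : ZMod 2) = 0 := by
      obtain ⟨y, rfl⟩ := Ideal.mem_span_singleton'.1 hx
      rw [← augmentation_eq_elemWeight, map_mul, map_sub, augmentation_hat hG, augmentation_hat hG,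
        sub_self, mul_zero]
    have hne : s ≠ x.coeff.support := by
      rintro rfl
      rw [elemWeight, hsc, natCast_zmod_two_of_odd (odd_card_subgroup hG H)] at heven
      exact one_ne_zero heven
    obtain ⟨g', hg', hgs⟩ := Finset.exists_of_ssubset (hs.ssubset_of_ne hne)
    obtain ⟨t, ht, htc, htm⟩ :=
      card_support_of_mem_code_hat hG hxH (Finsupp.mem_support_iff.1 hg')
    have hdisj : Disjoint s t := by
      rw [Finset.disjoint_left]
      intro k hks hkt
      rw [hsm] at hks hgs
      rw [htm] at hkt
      refine hgs ?_
      have := H.mul_mem (H.inv_mem hkt) hks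
      rwa [mul_inv_rev, inv_inv, mul_assoc, inv_mul_cancel_left] at this
    calc 2 * Nat.card H = (s ∪ t).card := by
          rw [Finset.card_union_of_disjoint hdisj, hsc, htc, two_mul]
      _ ≤ elemWeight x := Finset.card_le_card (Finset.union_subset hs ht)
  · obtain ⟨k, hkK, hkH⟩ := SetLike.exists_of_lt h
    have := Fintype.ofFinite G
    -- Two cosets `H` and `kH` with `k ∈ K \ H` attain the bound: `K̂` absorbs `k`, so it
    -- annihilates this element.
    set x : MonoidAlgebra (ZMod 2) G := hat (ZMod 2) H - single k 1 * hat (ZMod 2) H with hx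
    have hcoeff : ∀ g, x.coeff g = if g ∈ H ∨ k⁻¹ * g ∈ H then 1 else 0 := by
      intro g
      rw [hx, coeff_sub, Finsupp.sub_apply, coeff_single_mul_apply, one_mul, coeff_hat hG,
        coeff_hat hG]
      by_cases h1 : g ∈ H
      · have h2 : k⁻¹ * g ∉ H := by
          rw [H.mul_mem_cancel_right h1]
          simpa using hkH
        simp [h1, h2]
      · by_cases h2 : k⁻¹ * g ∈ H <;> simp [h1, h2]
    refine ⟨x, ?_, ?_, ?_⟩
    · rw [code, mem_span_singleton_iff_of_isIdempotentElem (isIdempotentElem_hat_sub_hat hG h.le),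
        sub_mul, hx, mul_sub, mul_sub, mul_left_comm, isIdempotentElem_hat hG, mul_left_comm,
        mul_comm (hat (ZMod 2) K), hat_mul_hat_of_le hG h.le, single_mul_hat hG hkK, sub_self,
        sub_zero]
    · intro h0
      have := hcoeff 1
      simp [h0, H.one_mem] at this
    · have hsupp : x.coeff.support =
          Finset.univ.filter (· ∈ H) ∪ (Finset.univ.filter (· ∈ H)).image (k * ·) := by
        ext g
        simp only [Finsupp.mem_support_iff, hcoeff, Finset.mem_union, Finset.mem_filter,
          Finset.mem_univ, true_and, Finset.mem_image]
        have : (∃ a ∈ H, k * a = g) ↔ k⁻¹ * g ∈ H :=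
          ⟨by rintro ⟨a, ha, rfl⟩; simpa using ha, fun hg => ⟨_, hg, mul_inv_cancel_left _ _⟩⟩
        rw [this]
        split_ifs with hc <;> simp [hc]
      rw [elemWeight, hsupp, Finset.card_union_of_disjoint,
        Finset.card_image_of_injective _ (mul_right_injective k), ← Fintype.card_subtype,
        Nat.card_eq_fintype_card, two_mul]
      · rw [Finset.disjoint_left]
        intro g hg hg'
        obtain ⟨a, ha, rfl⟩ := Finset.mem_image.1 hg'
        simp only [Finset.mem_filter, Finset.mem_univ, true_and] at hg ha
        exact hkH ((H.mul_mem_cancel_right ha).1 hg)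

end Code

/-! ### Orthogonal idempotents in commutative `𝔽₂`-algebras -/

section Idempotents

theorem span_injective_of_orthogonal {R ι : Type*} [CommRing R] {E : ι → R}
    (hE : OrthogonalIdempotents E) (hne : ∀ i, E i ≠ 0) :
    Function.Injective fun k => Ideal.span {E k} := by
  intro k l h
  by_contra hkl
  have := eq_of_span_singleton_eq_of_isIdempotentElem (hE.idem k) (hE.idem l) h
  have h0 : E k * E l = 0 := hE.ortho hkl
  rw [← this, hE.idem k] at h0
  exact hne k h0

variable {R : Type*} [CommRing R] [Algebra (ZMod 2) R] {ι : Type*} [Fintype ι]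

theorem add_self_eq_zero_of_algebra (x : R) : x + x = 0 := by
  have : (algebraMap (ZMod 2) R) (1 + 1) = 0 := by
    rw [show (1 + 1 : ZMod 2) = 0 from rfl, map_zero]
  rw [map_add, map_one] at this
  linear_combination x * this

theorem zmod_two_smul (c : ZMod 2) (x : R) : c • x = 0 ∨ c • x = x := by
  have : c = 0 ∨ c = 1 := by revert c; decide
  rcases this with rfl | rfl
  · exact Or.inl (zero_smul _ _)
  · exact Or.inr (one_smul _ _)

/-- The idempotents of a commutative `𝔽₂`-algebra form a subspace. -/
def idempotentSubmodule (R : Type*) [CommRing R] [Algebra (ZMod 2) R] :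
    Submodule (ZMod 2) R where
  carrier := {x | IsIdempotentElem x}
  zero_mem' := IsIdempotentElem.zero
  add_mem' := by
    intro x y hx hy
    have h := add_self_eq_zero_of_algebra (x * y)
    change (x + y) * (x + y) = x + y
    have hx' : x * x = x := hx
    have hy' : y * y = y := hy
    linear_combination hx' + hy' + h
  smul_mem' := by
    intro c x hx
    rcases zmod_two_smul c x with h | h <;> rw [h]
    · exact IsIdempotentElem.zero
    · exact hx

/-- If idempotents are determined by `|ι|` coordinates, then `|ι|` nonzero orthogonal idempotents
form a basis of the space of idempotents. -/
theorem exists_eq_sum_smul_of_isIdempotentElem {E : ι → R} (hE : OrthogonalIdempotents E)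
    (hne : ∀ i, E i ≠ 0) (φ : R →ₗ[ZMod 2] (ι → ZMod 2))
    (hφ : ∀ f, IsIdempotentElem f → φ f = 0 → f = 0) {f : R} (hf : IsIdempotentElem f) :
    ∃ c : ι → ZMod 2, f = ∑ i, c i • E i := by
  classical
  let V := idempotentSubmodule R
  let ψ : V →ₗ[ZMod 2] (ι → ZMod 2) := φ ∘ₗ V.subtype
  have hψ : Function.Injective ψ := by
    rw [← LinearMap.ker_eq_bot, LinearMap.ker_eq_bot']
    rintro ⟨x, hx⟩ h
    exact Subtype.ext (hφ x hx h)
  have : Module.Finite (ZMod 2) V := Module.Finite.of_injective ψ hψ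
  let E' : ι → V := fun i => ⟨E i, hE.idem i⟩
  have hli : LinearIndependent (ZMod 2) E' := by
    rw [Fintype.linearIndependent_iff]
    intro c hc k
    have hc' : ∑ i, c i • E i = 0 := by
      have := congrArg V.subtype hc
      simpa [E', map_sum] using this
    -- Multiplying the relation by `E k` isolates its `k`-th term.
    have hk : c k • E k = 0 := by
      have := congrArg (· * E k) hc'
      simp only [Finset.sum_mul, zero_mul] at this
      rw [Finset.sum_eq_single k] at this
      · rwa [smul_mul_assoc, hE.idem k] at this
      · intro i _ hik
        rw [smul_mul_assoc, hE.ortho hik, smul_zero]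
      · simp
    exact (smul_eq_zero.1 hk).resolve_right (hne k)
  -- Independence gives one inequality, the injection into `ι → ZMod 2` the other.
  have hcard : Fintype.card ι = Module.finrank (ZMod 2) V := by
    refine le_antisymm hli.fintype_card_le_finrank ?_
    have := LinearMap.finrank_le_finrank_of_injective hψ
    rwa [Module.finrank_fintype_fun_eq_card] at this
  have hspan := hli.span_eq_top_of_card_eq_finrank' hcard
  have hmem : (⟨f, hf⟩ : V) ∈ Submodule.span (ZMod 2) (Set.range E') := by
    rw [hspan]
    trivial
  obtain ⟨c, hc⟩ := (Submodule.mem_span_range_iff_exists_fun _).1 hmem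
  refine ⟨c, ?_⟩
  have := congrArg V.subtype hc
  simpa [E', map_sum, eq_comm] using this

variable {E : ι → R} (hE : OrthogonalIdempotents E) (hne : ∀ i, E i ≠ 0)
  (hspan : ∀ f, IsIdempotentElem f → ∃ c : ι → ZMod 2, f = ∑ i, c i • E i)

include hE hspan

/-- By orthogonality the product is `c k • E k`, and the only scalars are 0 and 1. Primitivity and
minimality both follow from this dichotomy. -/
theorem mul_eq_zero_or_eq_self_of_span {f : R} (hf : IsIdempotentElem f) (k : ι) :
    f * E k = 0 ∨ f * E k = E k := by
  classical
  obtain ⟨c, rfl⟩ := hspan f hf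
  have : (∑ i, c i • E i) * E k = c k • E k := by
    rw [Finset.sum_mul, Finset.sum_eq_single k]
    · rw [smul_mul_assoc, hE.idem k]
    · intro i _ hik
      rw [smul_mul_assoc, hE.ortho hik, smul_zero]
    · simp
  rw [this]
  exact zmod_two_smul _ _

theorem exists_mul_ne_zero_of_span {f : R} (hf : IsIdempotentElem f) (hf0 : f ≠ 0) :
    ∃ k, f * E k = E k := by
  by_contra! h
  obtain ⟨c, hc⟩ := hspan f hf
  refine hf0 ?_
  have h0 : ∀ k, f * E k = 0 := fun k =>
    (mul_eq_zero_or_eq_self_of_span hE hspan hf k).resolve_right (h k)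
  have hff : f * f = f := hf
  rw [← hff]
  nth_rw 2 [hc]
  rw [Finset.mul_sum]
  refine Finset.sum_eq_zero fun i _ => ?_
  rw [mul_smul_comm, h0, smul_zero]

include hne

theorem isPrimitiveIdempotent_of_span (k : ι) : IsPrimitiveIdempotent (E k) := by
  refine ⟨hE.idem k, hne k, fun f g hf hg hfg hk => ?_⟩
  have h1 : f * E k = f := by rw [hk, mul_add, hf, hfg, add_zero]
  rcases mul_eq_zero_or_eq_self_of_span hE hspan hf k with h | h
  · exact Or.inl (h1 ▸ h)
  · right
    rw [h1, hk] at h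
    exact left_eq_add.1 h

variable [IsSemisimpleRing R]

/-- By semisimplicity a smaller ideal has an idempotent generator `f = f * E k`, to which the
dichotomy applies. -/
theorem isAtom_span_of_span (k : ι) : IsAtom (Ideal.span {E k}) := by
  refine ⟨fun h => hne k (Ideal.span_singleton_eq_bot.1 h), fun J hJ => ?_⟩
  obtain ⟨f, hf, rfl⟩ := IsSemisimpleRing.ideal_eq_span_idempotent J
  have hfk : E k * f = f :=
    (mem_span_singleton_iff_of_isIdempotentElem (hE.idem k)).1
      (hJ.le (Ideal.mem_span_singleton_self f))
  rw [mul_comm] at hfk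
  rcases mul_eq_zero_or_eq_self_of_span hE hspan hf k with h | h
  · rw [Ideal.span_singleton_eq_bot, ← hfk, h]
  · rw [← hfk, h] at hJ
    exact absurd rfl hJ.ne

theorem isAtom_iff_of_span (I : Ideal R) : IsAtom I ↔ ∃ k, I = Ideal.span {E k} := by
  refine ⟨fun hI => ?_, ?_⟩
  · obtain ⟨f, hf, rfl⟩ := IsSemisimpleRing.ideal_eq_span_idempotent I
    obtain ⟨k, hk⟩ := exists_mul_ne_zero_of_span hE hspan hf
      (fun h => hI.1 (Ideal.span_singleton_eq_bot.2 h))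
    refine ⟨k, ?_⟩
    have hle : Ideal.span {E k} ≤ Ideal.span {f} := by
      rw [Ideal.span_singleton_le_iff_mem, mem_span_singleton_iff_of_isIdempotentElem hf, hk]
    rcases hI.le_iff.1 hle with h | h
    · exact absurd (Ideal.span_singleton_eq_bot.1 h) (hne k)
    · exact h.symm
  · rintro ⟨k, rfl⟩
    exact isAtom_span_of_span hE hne hspan k

end Idempotents

/-! ### Frobenius and the coefficients of idempotents -/

section Squaring

variable {G : Type*} [CommGroup G]

/-- Frobenius fixes the scalars `𝔽₂`, so it is the ring map induced by `g ↦ g²`, which is injective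
in odd order. An idempotent equals its own image under it. -/
theorem coeff_sq_of_isIdempotentElem (hG : Odd (Nat.card G)) {f : MonoidAlgebra (ZMod 2) G}
    (hf : IsIdempotentElem f) (g : G) : f.coeff (g ^ 2) = f.coeff g := by
  have : CharP (MonoidAlgebra (ZMod 2) G) 2 :=
    charP_of_injective_algebraMap (algebraMap (ZMod 2) (MonoidAlgebra (ZMod 2) G)).injective 2
  have hfrob : frobenius (MonoidAlgebra (ZMod 2) G) 2 =
      mapDomainRingHom (ZMod 2) (powMonoidHom 2 : G →* G) := by
    refine ringHom_ext (fun r => ?_) (fun m => ?_)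
    · have : r ^ 2 = r := by revert r; decide
      simp [frobenius_def, single_pow, this]
    · simp [frobenius_def, single_pow]
  have hinj : Function.Injective (powMonoidHom 2 : G →* G) :=
    (powCoprime (Nat.coprime_two_right.2 hG)).injective
  have h1 : mapDomain (powMonoidHom 2 : G →* G) f = f := by
    have := congrArg (fun φ => φ f) hfrob
    simp only [frobenius_def, mapDomainRingHom_apply, pow_two] at this
    rw [← this, hf]
  conv_lhs => rw [← h1]
  exact Finsupp.mapDomain_apply hinj _ _

theorem coeff_pow_two_pow_of_isIdempotentElem (hG : Odd (Nat.card G))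
    {f : MonoidAlgebra (ZMod 2) G} (hf : IsIdempotentElem f) (g : G) (k : ℕ) :
    f.coeff (g ^ 2 ^ k) = f.coeff g := by
  induction k with
  | zero => simp
  | succ k ih => rw [pow_succ, pow_mul, coeff_sq_of_isIdempotentElem hG hf, ih]

end Squaring

/-! ### The group `⟨a⟩ × ⟨b⟩` and its subgroups -/

open Subgroup

/-- `G = ⟨a⟩ × ⟨b⟩` with `o(a) = p²`, `o(b) = p`, where `p` is an odd prime and `2` generates the
unit group of `ℤ/p²`. -/
structure IsProdSqPrime (p : ℕ) {G : Type*} [CommGroup G] (a b : G) : Prop where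
  prime : p.Prime
  odd : Odd p
  two_generates : ∃ u : (ZMod (p ^ 2))ˣ, (u : ZMod (p ^ 2)) = 2 ∧ Subgroup.zpowers u = ⊤
  orderOf_left : orderOf a = p ^ 2
  orderOf_right : orderOf b = p
  isCompl : IsCompl (Subgroup.zpowers a) (Subgroup.zpowers b)

/-- Bézout for `p` and `n` writes `x` as a power of `x ^ n`. -/
theorem mem_of_zpow_mem {G : Type*} [CommGroup G] {p : ℕ} (hp : p.Prime) {x : G} (hx : x ^ p = 1)
    {n : ℤ} (hn : ¬ (p : ℤ) ∣ n) {S : Subgroup G} (h : x ^ n ∈ S) : x ∈ S := by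
  obtain ⟨u, v, huv⟩ := (Nat.prime_iff_prime_int.1 hp).coprime_iff_not_dvd.2 hn
  have : x = (x ^ n) ^ v := by
    have h1 : x ^ (u * p + v * n) = x := by rw [huv, zpow_one]
    rw [zpow_add, mul_comm u, zpow_mul, zpow_natCast, hx, one_zpow, one_mul, mul_comm, zpow_mul]
      at h1
    exact h1.symm
  rw [this]
  exact S.zpow_mem h v

theorem lt_of_le_of_card_lt {G : Type*} [Group G] {H K : Subgroup G} (hle : H ≤ K) (hc : Nat.card H < Nat.card K) : H < K :=
  lt_of_le_of_ne hle fun he => hc.ne (by rw [he])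

namespace IsProdSqPrime

variable {p : ℕ} {G : Type*} [CommGroup G] {a b : G}

theorem zpowers_pow_mul_le (j : ℕ) :
    zpowers (a ^ (j * p) * b) ≤ zpowers (a ^ p) ⊔ zpowers b := by
  rw [zpowers_le, mul_comm j, pow_mul]
  exact Subgroup.mul_mem _ (mem_sup_left (pow_mem (mem_zpowers _) j)) (mem_sup_right (mem_zpowers _))

variable (h : IsProdSqPrime p a b)

include h

theorem pow_left : a ^ (p ^ 2) = 1 := h.orderOf_left ▸ pow_orderOf_eq_one a

theorem pow_pow_left : (a ^ p) ^ p = 1 := by rw [← pow_mul, ← pow_two, h.pow_left]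

theorem pow_right : b ^ p = 1 := by
  conv_lhs => rw [← h.orderOf_right]
  exact pow_orderOf_eq_one b

theorem pow_left_ne_one : a ^ p ≠ 1 := by
  intro h1
  have := orderOf_dvd_of_pow_eq_one h1
  rw [h.orderOf_left] at this
  have := Nat.le_of_dvd h.prime.pos this
  nlinarith [h.prime.one_lt]

theorem right_ne_one : b ≠ 1 := by
  rintro rfl
  have := h.orderOf_right
  rw [orderOf_one] at this
  exact h.prime.one_lt.ne this

theorem exists_eq_zpow_mul_zpow (g : G) : ∃ x y : ℤ, g = a ^ x * b ^ y := by
  have hg : g ∈ zpowers a ⊔ zpowers b := h.isCompl.sup_eq_top ▸ mem_top g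
  obtain ⟨_, ⟨x, rfl⟩, _, ⟨y, rfl⟩, rfl⟩ := Subgroup.mem_sup.1 hg
  exact ⟨x, y, rfl⟩

theorem card_eq : Nat.card G = p ^ 3 := by
  have hc : (zpowers a).IsComplement' (zpowers b) := by
    refine isComplement'_of_disjoint_and_mul_eq_univ h.isCompl.disjoint (Set.eq_univ_of_forall ?_)
    intro g
    obtain ⟨x, y, rfl⟩ := h.exists_eq_zpow_mul_zpow g
    exact Set.mul_mem_mul ⟨x, rfl⟩ ⟨y, rfl⟩
  rw [← hc.card_mul_card, Nat.card_zpowers, Nat.card_zpowers, h.orderOf_left, h.orderOf_right,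
    ← pow_succ]

theorem finite : Finite G :=
  Nat.finite_of_card_ne_zero (h.card_eq ▸ (pow_pos h.prime.pos 3).ne')

theorem odd_card : Odd (Nat.card G) := h.card_eq ▸ h.odd.pow

theorem pow_sq_eq_one (g : G) : g ^ (p ^ 2) = 1 := by
  obtain ⟨x, y, rfl⟩ := h.exists_eq_zpow_mul_zpow g
  rw [mul_pow, ← zpow_natCast, ← zpow_natCast, zpow_comm, zpow_comm b, zpow_natCast, zpow_natCast,
    h.pow_left, pow_two p, pow_mul b, h.pow_right, one_pow, one_zpow, one_zpow, one_mul]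

theorem exponent_eq : Monoid.exponent G = p ^ 2 := by
  refine Nat.dvd_antisymm (Monoid.exponent_dvd_iff_forall_pow_eq_one.2 h.pow_sq_eq_one) ?_
  rw [← h.orderOf_left]
  exact Monoid.order_dvd_exponent a

theorem eq_top_of_mem {S : Subgroup G} (ha : a ∈ S) (hb : b ∈ S) : S = ⊤ := by
  rw [eq_top_iff, ← h.isCompl.sup_eq_top, sup_le_iff, zpowers_le, zpowers_le]
  exact ⟨ha, hb⟩

theorem mul_pow_prime (i : ℕ) : (a * b ^ i) ^ p = a ^ p := by
  rw [mul_pow, ← pow_mul, mul_comm i, pow_mul, h.pow_right, one_pow, mul_one]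

theorem pow_mul_pow_prime (j : ℕ) : (a ^ (j * p) * b) ^ p = 1 := by
  rw [mul_pow, h.pow_right, mul_one, mul_comm j, pow_mul, ← pow_mul, mul_comm j, pow_mul,
    h.pow_pow_left, one_pow]

theorem zpowers_mul_sup_zpowers_mul {i i' : ℕ} (hi : i < p) (hi' : i' < p) (hne : i ≠ i') :
    zpowers (a * b ^ i) ⊔ zpowers (a * b ^ i') = ⊤ := by
  set S := zpowers (a * b ^ i) ⊔ zpowers (a * b ^ i')
  have h1 : a * b ^ i ∈ S := mem_sup_left (mem_zpowers _)
  have h2 : a * b ^ i' ∈ S := mem_sup_right (mem_zpowers _)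
  have hb : b ∈ S := by
    -- The quotient of the two generators is `b ^ (i - i')`, and `0 < |i - i'| < p`.
    refine mem_of_zpow_mem (n := (i : ℤ) - i') h.prime h.pow_right ?_ ?_
    · intro hd
      refine hne ?_
      have := Int.eq_zero_of_abs_lt_dvd hd (by rw [abs_lt]; omega)
      omega
    · have := S.div_mem h1 h2
      rwa [mul_div_mul_left_eq_div, ← zpow_natCast, ← zpow_natCast, div_eq_mul_inv, ← zpow_sub] at this
  exact h.eq_top_of_mem ((S.mul_mem_cancel_right (S.pow_mem hb i)).1 h1) hb

theorem eq_top_of_mul_mem {S : Subgroup G} {i : ℕ} (ha : a * b ^ i ∈ S) (hb : b ∈ S) : S = ⊤ :=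
  h.eq_top_of_mem ((S.mul_mem_cancel_right (S.pow_mem hb i)).1 ha) hb

theorem zpowers_mul_sup_zpowers_pow_sup (i : ℕ) :
    zpowers (a * b ^ i) ⊔ (zpowers (a ^ p) ⊔ zpowers b) = ⊤ :=
  h.eq_top_of_mul_mem (i := i) (mem_sup_left (mem_zpowers _))
    (mem_sup_right (mem_sup_right (mem_zpowers _)))

theorem zpowers_mul_sup_zpowers_pow_mul (i j : ℕ) :
    zpowers (a * b ^ i) ⊔ zpowers (a ^ (j * p) * b) = ⊤ := by
  set S := zpowers (a * b ^ i) ⊔ zpowers (a ^ (j * p) * b)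
  have h1 : a * b ^ i ∈ S := mem_sup_left (mem_zpowers _)
  have h2 : a ^ (j * p) * b ∈ S := mem_sup_right (mem_zpowers _)
  have h3 : a ^ p ∈ S := h.mul_pow_prime i ▸ S.pow_mem h1 p
  refine h.eq_top_of_mul_mem h1 ?_
  refine (S.mul_mem_cancel_left ?_).1 h2
  rw [mul_comm, pow_mul]
  exact S.pow_mem h3 j

theorem zpowers_pow_mul_sup_zpowers_pow_mul {j j' : ℕ} (hj : j < p) (hj' : j' < p) (hne : j ≠ j') :
    zpowers (a ^ (j * p) * b) ⊔ zpowers (a ^ (j' * p) * b) = zpowers (a ^ p) ⊔ zpowers b := by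
  refine le_antisymm (sup_le (zpowers_pow_mul_le j) (zpowers_pow_mul_le j')) ?_
  set S := zpowers (a ^ (j * p) * b) ⊔ zpowers (a ^ (j' * p) * b)
  have h1 : a ^ (j * p) * b ∈ S := mem_sup_left (mem_zpowers _)
  have h2 : a ^ (j' * p) * b ∈ S := mem_sup_right (mem_zpowers _)
  have ha : a ^ p ∈ S := by
    -- The quotient of the two generators is `(a ^ p) ^ (j - j')`.
    refine mem_of_zpow_mem (n := (j : ℤ) - j') h.prime h.pow_pow_left ?_ ?_
    · intro hd
      refine hne ?_
      have := Int.eq_zero_of_abs_lt_dvd hd (by rw [abs_lt]; omega)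
      omega
    · have := S.div_mem h1 h2
      rwa [mul_div_mul_right_eq_div, mul_comm j, mul_comm j', pow_mul, pow_mul, ← zpow_natCast _ j,
        ← zpow_natCast _ j', div_eq_mul_inv, ← zpow_sub] at this
  rw [sup_le_iff, zpowers_le, zpowers_le]
  refine ⟨ha, (S.mul_mem_cancel_left ?_).1 h1⟩
  rw [mul_comm, pow_mul]
  exact S.pow_mem ha j

theorem card_zpowers_mul (i : ℕ) : Nat.card (zpowers (a * b ^ i)) = p ^ 2 := by
  have := Fact.mk h.prime
  rw [Nat.card_zpowers]
  refine orderOf_eq_prime_pow (n := 1) ?_ (h.pow_sq_eq_one _)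
  rw [pow_one, h.mul_pow_prime]
  exact h.pow_left_ne_one

theorem card_zpowers_pow_mul (j : ℕ) : Nat.card (zpowers (a ^ (j * p) * b)) = p := by
  have := Fact.mk h.prime
  rw [Nat.card_zpowers]
  refine orderOf_eq_prime (h.pow_mul_pow_prime j) fun h1 => h.right_ne_one ?_
  have hb : b ∈ zpowers a := by
    rw [← inv_eq_of_mul_eq_one_right h1]
    exact Subgroup.inv_mem _ (pow_mem (mem_zpowers a) _)
  exact Subgroup.disjoint_def.1 h.isCompl.disjoint hb (mem_zpowers b)

theorem pow_eq_one_of_mem {x : G} (hx : x ∈ zpowers (a ^ p) ⊔ zpowers b) : x ^ p = 1 := by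
  have : zpowers (a ^ p) ⊔ zpowers b ≤ (powMonoidHom p : G →* G).ker := by
    rw [sup_le_iff, zpowers_le, zpowers_le]
    exact ⟨h.pow_pow_left, h.pow_right⟩
  exact this hx

/-- The order divides `p³`; the subgroup properly contains `⟨b⟩`, and it is not `G` because it has
exponent `p`. -/
theorem card_zpowers_pow_sup : Nat.card (zpowers (a ^ p) ⊔ zpowers b : Subgroup G) = p ^ 2 := by
  have := h.finite
  set P := zpowers (a ^ p) ⊔ zpowers b with hP
  have hdvd : Nat.card P ∣ p ^ 3 := h.card_eq ▸ P.card_subgroup_dvd_card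
  obtain ⟨k, hk, hcard⟩ := (Nat.dvd_prime_pow h.prime).1 hdvd
  have hb : Nat.card (zpowers b) = p := by rw [Nat.card_zpowers, h.orderOf_right]
  have hle : zpowers b ≤ P := le_sup_right
  have h0 : k ≠ 0 := by
    rintro rfl
    have := Nat.le_of_dvd Nat.card_pos (card_dvd_of_le hle)
    rw [hb, hcard, pow_zero] at this
    exact absurd h.prime.one_lt this.not_gt
  have h1 : k ≠ 1 := by
    rintro rfl
    have heq : zpowers b = P := eq_of_le_of_card_ge hle (by rw [hb, hcard, pow_one])
    have hmem : a ^ p ∈ zpowers b := heq ▸ mem_sup_left (mem_zpowers _)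
    exact h.pow_left_ne_one
      (Subgroup.disjoint_def.1 h.isCompl.disjoint (pow_mem (mem_zpowers a) p) hmem)
  have h3 : k ≠ 3 := by
    rintro rfl
    have htop : P = ⊤ := eq_top_of_card_eq P (by rw [hcard, h.card_eq])
    exact h.pow_left_ne_one (h.pow_eq_one_of_mem (hP ▸ htop ▸ mem_top a))
  have : k = 2 := by omega
  rw [hcard, this]

theorem zpowers_pow_mul_lt (j : ℕ) :
    zpowers (a ^ (j * p) * b) < zpowers (a ^ p) ⊔ zpowers b := by
  refine lt_of_le_of_card_lt (zpowers_pow_mul_le j) ?_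
  rw [h.card_zpowers_pow_mul, h.card_zpowers_pow_sup]
  nlinarith [h.prime.one_lt]

theorem lt_top_of_card {H : Subgroup G} (hc : Nat.card H = p ^ 2) : H < ⊤ := by
  refine lt_of_le_of_card_lt le_top ?_
  rw [hc, card_top, h.card_eq]
  exact Nat.pow_lt_pow_right h.prime.one_lt (by norm_num)

theorem index_of_card {H : Subgroup G} {m n : ℕ} (hc : Nat.card H = p ^ m) (hmn : m + n = 3) :
    H.index = p ^ n := by
  have := H.card_mul_index
  rw [hc, h.card_eq, ← hmn, pow_add] at this
  exact Nat.eq_of_mul_eq_mul_left (pow_pos h.prime.pos m) this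

theorem zpow_eq_zpow_of_dvd (x : G) {m n : ℤ} (hmn : ((p ^ 2 : ℕ) : ℤ) ∣ m - n) :
    x ^ m = x ^ n := by
  obtain ⟨c, hc⟩ := hmn
  rw [eq_add_of_sub_eq hc, zpow_add, zpow_mul, zpow_natCast, h.pow_sq_eq_one, one_zpow, one_mul]

/-- This is where 2 generating the units is used: `w` is a unit mod `p²`, hence congruent to some `2
^ k`, so `x ^ w` arises from `x` by repeated squaring. -/
theorem coeff_zpow_of_isIdempotentElem {f : MonoidAlgebra (ZMod 2) G} (hf : IsIdempotentElem f)
    (x : G) {w : ℤ} (hw : ¬ (p : ℤ) ∣ w) : f.coeff (x ^ w) = f.coeff x := by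
  have := Fact.mk h.prime
  have : NeZero (p ^ 2) := ⟨(pow_pos h.prime.pos 2).ne'⟩
  obtain ⟨u, hu, hgen⟩ := h.two_generates
  have hunit : IsUnit (w : ZMod (p ^ 2)) := by
    rw [ZMod.coe_int_isUnit_iff_isCoprime, Nat.cast_pow]
    exact ((Nat.prime_iff_prime_int.1 h.prime).coprime_iff_not_dvd.2 hw).pow_left
  obtain ⟨k, hk⟩ : ∃ k : ℕ, u ^ k = hunit.unit := by
    have : hunit.unit ∈ zpowers u := hgen ▸ mem_top _
    exact (mem_powers_iff_mem_zpowers).2 this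
  have hk' : ((2 ^ k : ℕ) : ZMod (p ^ 2)) = w := by
    have := congrArg (Units.val) hk
    rw [Units.val_pow_eq_pow_val, hu, IsUnit.unit_spec] at this
    rw [← this]
    push_cast
    rfl
  have hd : ((p ^ 2 : ℕ) : ℤ) ∣ w - (2 ^ k : ℕ) := by
    rw [← ZMod.intCast_zmod_eq_zero_iff_dvd]
    push_cast at hk' ⊢
    rw [hk', sub_self]
  rw [h.zpow_eq_zpow_of_dvd x hd, zpow_natCast, coeff_pow_two_pow_of_isIdempotentElem h.odd_card hf]

end IsProdSqPrime

/-- Representatives of the orbits of `G` under squaring. -/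
def orbitRep (p : ℕ) {G : Type*} [CommGroup G] (a b : G) : Fin 2 ⊕ (Fin p ⊕ Fin p) → G :=
  Sum.elim ![1, a ^ p] (Sum.elim (fun j => a ^ ((j : ℕ) * p) * b) fun i => a * b ^ (i : ℕ))

/-- The primitive idempotents of `𝔽₂ G`. -/
def primIdem (p : ℕ) {G : Type*} [CommGroup G] (a b : G) :
    Fin 2 ⊕ (Fin p ⊕ Fin p) → MonoidAlgebra (ZMod 2) G :=
  Sum.elim ![e₀ G, e₃ p a b] (Sum.elim (fun j => e₁ p a b j) fun i => e₂ a b i)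

/-! ### The complete list of primitive idempotents, with dimensions and weights -/

namespace IsProdSqPrime

variable {p : ℕ} {G : Type*} [CommGroup G] {a b : G} (h : IsProdSqPrime p a b)

include h

theorem exists_lt_dvd (x y : ℤ) (hx : ¬ (p : ℤ) ∣ x) : ∃ i < p, (p : ℤ) ∣ i * x - y := by
  have := Fact.mk h.prime
  have hx0 : (x : ZMod p) ≠ 0 := by rwa [Ne, ZMod.intCast_zmod_eq_zero_iff_dvd]
  refine ⟨((y : ZMod p) * (x : ZMod p)⁻¹).val, ZMod.val_lt _, ?_⟩
  rw [← ZMod.intCast_zmod_eq_zero_iff_dvd]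
  push_cast
  rw [ZMod.natCast_zmod_val, inv_mul_cancel_right₀ hx0, sub_self]

/-- Only covering is needed, not distinctness of the orbits: the independent idempotents supply the
matching lower bound. -/
theorem exists_eq_orbitRep_zpow (g : G) :
    ∃ k, ∃ w : ℤ, ¬ (p : ℤ) ∣ w ∧ g = orbitRep p a b k ^ w := by
  obtain ⟨x, y, rfl⟩ := h.exists_eq_zpow_mul_zpow g
  have hbz : ∀ m n : ℤ, (p : ℤ) ∣ m - n → b ^ m = b ^ n := by
    rintro m n ⟨c, hc⟩
    rw [eq_add_of_sub_eq hc, zpow_add, zpow_mul, zpow_natCast, h.pow_right, one_zpow, one_mul]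
  by_cases hx : (p : ℤ) ∣ x
  · obtain ⟨x, rfl⟩ := hx
    by_cases hy : (p : ℤ) ∣ y
    · have hb1 : b ^ y = 1 := by rw [hbz y 0 (by simpa using hy), zpow_zero]
      rw [hb1, mul_one, zpow_mul, zpow_natCast]
      by_cases hx : (p : ℤ) ∣ x
      · obtain ⟨c, rfl⟩ := hx
        refine ⟨Sum.inl 0, 1, (Nat.prime_iff_prime_int.1 h.prime).not_dvd_one, ?_⟩
        rw [zpow_mul, zpow_natCast, h.pow_pow_left]
        simp [orbitRep]
      · exact ⟨Sum.inl 1, x, hx, rfl⟩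
    -- Here `g = a^{px} b^y`, and `j` solves `j y ≡ x` mod `p`.
    · obtain ⟨j, hj, c, hc⟩ := h.exists_lt_dvd y x hy
      refine ⟨Sum.inr (Sum.inl ⟨j, hj⟩), y, hy, ?_⟩
      change _ = (a ^ (j * p) * b) ^ y
      rw [mul_zpow, ← zpow_natCast, ← zpow_mul]
      congr 1
      symm
      apply h.zpow_eq_zpow_of_dvd
      refine ⟨c, ?_⟩
      push_cast
      linear_combination (p : ℤ) * hc
  -- Here `i` solves `i x ≡ y` mod `p`.
  · obtain ⟨i, hi, hd⟩ := h.exists_lt_dvd x y hx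
    refine ⟨Sum.inr (Sum.inr ⟨i, hi⟩), x, hx, ?_⟩
    change _ = (a * b ^ i) ^ x
    rw [mul_zpow, ← zpow_natCast, ← zpow_mul, hbz _ _ hd]

theorem orthogonalIdempotents : OrthogonalIdempotents (primIdem p a b) := by
  have := h.finite
  have hG := h.odd_card
  have e00 : e₀ G * e₀ G = e₀ G := isIdempotentElem_hat hG _
  have e33 : e₃ p a b * e₃ p a b = e₃ p a b := isIdempotentElem_hat_sub_hat hG le_top
  have e11 : ∀ j, e₁ p a b j * e₁ p a b j = e₁ p a b j := fun j =>
    isIdempotentElem_hat_sub_hat hG (zpowers_pow_mul_le j)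
  have e22 : ∀ i, e₂ a b i * e₂ a b i = e₂ a b i := fun i =>
    isIdempotentElem_hat_sub_hat hG le_top
  have e03 : e₀ G * e₃ p a b = 0 := by
    simp [e₀, e₃, mul_sub, hat_mul_hat hG]
  have e01 : ∀ j, e₀ G * e₁ p a b j = 0 := fun j => by
    simp [e₀, e₁, mul_sub, hat_mul_hat hG]
  have e02 : ∀ i, e₀ G * e₂ a b i = 0 := fun i => by
    simp [e₀, e₂, mul_sub, hat_mul_hat hG]
  have e13 : ∀ j, e₁ p a b j * e₃ p a b = 0 := fun j => by
    simp only [e₁, e₃, mul_sub, sub_mul, hat_mul_hat hG, sup_top_eq, sup_idem,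
      sup_eq_right.2 (zpowers_pow_mul_le (p := p) (a := a) (b := b) j), sub_self]
  have e23 : ∀ i, e₂ a b i * e₃ p a b = 0 := fun i => by
    simp only [e₂, e₃, mul_sub, sub_mul, hat_mul_hat hG, sup_top_eq, top_sup_eq, sup_idem,
      h.zpowers_mul_sup_zpowers_pow_sup, sub_self]
  have e21 : ∀ i j, e₂ a b i * e₁ p a b j = 0 := fun i j => by
    simp only [e₂, e₁, mul_sub, sub_mul, hat_mul_hat hG, top_sup_eq,
      h.zpowers_mul_sup_zpowers_pow_sup, h.zpowers_mul_sup_zpowers_pow_mul, sub_self]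
  have e12 : ∀ j j', j < p → j' < p → j ≠ j' → e₁ p a b j * e₁ p a b j' = 0 := by
    intro j j' hj hj' hne
    simp only [e₁, mul_sub, sub_mul, hat_mul_hat hG, sup_idem,
      h.zpowers_pow_mul_sup_zpowers_pow_mul hj hj' hne,
      sup_eq_right.2 (zpowers_pow_mul_le (p := p) (a := a) (b := b) j),
      sup_eq_left.2 (zpowers_pow_mul_le (p := p) (a := a) (b := b) j'), sub_self]
  have e2' : ∀ i i', i < p → i' < p → i ≠ i' → e₂ a b i * e₂ a b i' = 0 := by
    intro i i' hi hi' hne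
    simp only [e₂, mul_sub, sub_mul, hat_mul_hat hG, sup_idem, sup_top_eq, top_sup_eq,
      h.zpowers_mul_sup_zpowers_mul hi hi' hne, sub_self]
  constructor
  · rintro (k | j | i)
    · fin_cases k
      · exact e00
      · exact e33
    · exact e11 j
    · exact e22 i
  · rintro (k | j | i) (k' | j' | i') hne
    · fin_cases k <;> fin_cases k'
      · exact absurd rfl hne
      · exact e03
      · exact (mul_comm _ _).trans e03
      · exact absurd rfl hne
    · fin_cases k
      · exact e01 _
      · exact (mul_comm _ _).trans (e13 _)
    · fin_cases k
      · exact e02 _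
      · exact (mul_comm _ _).trans (e23 _)
    · fin_cases k'
      · exact (mul_comm _ _).trans (e01 _)
      · exact e13 _
    · exact e12 _ _ j.2 j'.2 fun hj => hne (by rw [Fin.ext hj])
    · exact (mul_comm _ _).trans (e21 _ _)
    · fin_cases k'
      · exact (mul_comm _ _).trans (e02 _)
      · exact e23 _
    · exact e21 _ _
    · exact e2' _ _ i.2 i'.2 fun hi => hne (by rw [Fin.ext hi])

theorem hat_sub_hat_ne_zero {H K : Subgroup G} (hlt : H < K) :
    hat (ZMod 2) H - hat (ZMod 2) K ≠ 0 := by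
  have := h.finite
  exact fun h0 => hlt.ne (hat_injective h.odd_card (sub_eq_zero.1 h0))

theorem primIdem_ne_zero : ∀ k, primIdem p a b k ≠ 0 := by
  have := h.finite
  rintro (k | j | i)
  · fin_cases k
    · exact hat_ne_zero h.odd_card _
    · exact h.hat_sub_hat_ne_zero (h.lt_top_of_card h.card_zpowers_pow_sup)
  · exact h.hat_sub_hat_ne_zero (h.zpowers_pow_mul_lt j)
  · exact h.hat_sub_hat_ne_zero (h.lt_top_of_card (h.card_zpowers_mul i))

theorem exists_eq_sum {f : MonoidAlgebra (ZMod 2) G} (hf : IsIdempotentElem f) :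
    ∃ c : Fin 2 ⊕ (Fin p ⊕ Fin p) → ZMod 2, f = ∑ k, c k • primIdem p a b k := by
  refine exists_eq_sum_smul_of_isIdempotentElem h.orthogonalIdempotents h.primIdem_ne_zero
    -- The coordinates are the coefficients at the orbit representatives, which determine an
    -- idempotent.
    (LinearMap.pi fun k => Finsupp.lapply (orbitRep p a b k) ∘ₗ
      (coeffLinearEquiv (ZMod 2)).toLinearMap) ?_ hf
  intro f hf h0
  ext g
  obtain ⟨k, w, hw, rfl⟩ := h.exists_eq_orbitRep_zpow g
  rw [h.coeff_zpow_of_isIdempotentElem hf _ hw]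
  exact congrFun h0 k

theorem isSemisimpleRing : IsSemisimpleRing (MonoidAlgebra (ZMod 2) G) := by
  have := h.finite
  have : NeZero (Nat.card G : ZMod 2) :=
    ⟨by rw [natCast_zmod_two_of_odd h.odd_card]; exact one_ne_zero⟩
  infer_instance

theorem isPrimitiveIdempotent_primIdem (k) : IsPrimitiveIdempotent (primIdem p a b k) :=
  isPrimitiveIdempotent_of_span h.orthogonalIdempotents h.primIdem_ne_zero
    (fun _ hf => h.exists_eq_sum hf) k

theorem isMinimalCode_iff (I : Ideal (MonoidAlgebra (ZMod 2) G)) :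
    IsMinimalCode I ↔ ∃ k, I = code (primIdem p a b k) :=
  have := h.isSemisimpleRing
  isAtom_iff_of_span h.orthogonalIdempotents h.primIdem_ne_zero (fun _ hf => h.exists_eq_sum hf) I

theorem ncard_isMinimalCode :
    {I : Ideal (MonoidAlgebra (ZMod 2) G) | IsMinimalCode I}.ncard = 2 * p + 2 := by
  have : {I : Ideal (MonoidAlgebra (ZMod 2) G) | IsMinimalCode I} =
      Set.range fun k => Ideal.span {primIdem p a b k} := by
    ext I
    rw [Set.mem_ofPred_eq, h.isMinimalCode_iff]
    exact exists_congr fun k => eq_comm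
  rw [this, Set.ncard_range_of_injective
    (span_injective_of_orthogonal h.orthogonalIdempotents h.primIdem_ne_zero),
    Nat.card_eq_fintype_card]
  simp only [Fintype.card_sum, Fintype.card_fin]
  omega

theorem dim_e₀ : dim (code (e₀ G)) = 1 := by
  have := h.finite
  rw [e₀, dim_code_hat h.odd_card, index_top]

theorem weight_e₀ : weight (code (e₀ G)) = p ^ 3 := by
  have := h.finite
  rw [e₀, weight_code_hat h.odd_card, card_top, h.card_eq]

theorem dim_e₁ (j : ℕ) : dim (code (e₁ p a b j)) = p ^ 2 - p := by
  have := h.finite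
  rw [e₁, dim_code_hat_sub_hat h.odd_card (zpowers_pow_mul_le j),
    h.index_of_card (m := 1) (n := 2) ((h.card_zpowers_pow_mul j).trans (pow_one p).symm) rfl,
    h.index_of_card (m := 2) (n := 1) h.card_zpowers_pow_sup rfl, pow_one]

theorem weight_e₁ (j : ℕ) : weight (code (e₁ p a b j)) = 2 * p := by
  have := h.finite
  rw [e₁, weight_code_hat_sub_hat h.odd_card (h.zpowers_pow_mul_lt j), h.card_zpowers_pow_mul]

theorem dim_e₂ (i : ℕ) : dim (code (e₂ a b i)) = p - 1 := by
  have := h.finite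
  rw [e₂, dim_code_hat_sub_hat h.odd_card le_top,
    h.index_of_card (m := 2) (n := 1) (h.card_zpowers_mul i) rfl, index_top, pow_one]

theorem weight_e₂ (i : ℕ) : weight (code (e₂ a b i)) = 2 * p ^ 2 := by
  have := h.finite
  rw [e₂, weight_code_hat_sub_hat h.odd_card (h.lt_top_of_card (h.card_zpowers_mul i)),
    h.card_zpowers_mul]

theorem dim_e₃ : dim (code (e₃ p a b)) = p - 1 := by
  have := h.finite
  rw [e₃, dim_code_hat_sub_hat h.odd_card le_top,
    h.index_of_card (m := 2) (n := 1) h.card_zpowers_pow_sup rfl, index_top, pow_one]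

theorem weight_e₃ : weight (code (e₃ p a b)) = 2 * p ^ 2 := by
  have := h.finite
  rw [e₃, weight_code_hat_sub_hat h.odd_card (h.lt_top_of_card h.card_zpowers_pow_sup),
    h.card_zpowers_pow_sup]

end IsProdSqPrime

/-! ### Behaviour of codes under automorphisms -/

section GEquivalence

theorem gEquivalent_code_domCongr {F : Type*} [Field F] {G : Type*} [CommGroup G] (ψ : G ≃* G)
    (e : MonoidAlgebra F G) : GEquivalent (code e) (code (domCongr F F ψ e)) := by
  refine ⟨ψ, ?_⟩
  ext x
  simp only [Set.mem_image, SetLike.mem_coe, code, Ideal.mem_span_singleton']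
  constructor
  · rintro ⟨_, ⟨c, rfl⟩, rfl⟩
    exact ⟨domCongr F F ψ c, (map_mul _ _ _).symm⟩
  · rintro ⟨c, rfl⟩
    refine ⟨_, ⟨(domCongr F F ψ).symm c, rfl⟩, ?_⟩
    rw [map_mul, AlgEquiv.apply_symm_apply]

/-- An ideal has at most one idempotent generator, so an equivalence of ideals already matches the
generators. -/
theorem GEquivalent.exists_domCongr_eq {F : Type*} [Field F] {G : Type*} [CommGroup G]
    {e f : MonoidAlgebra F G} (he : IsIdempotentElem e) (hf : IsIdempotentElem f)
    (h : GEquivalent (code e) (code f)) : ∃ ψ : G ≃* G, domCongr F F ψ e = f := by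
  obtain ⟨ψ, hψ⟩ := h
  refine ⟨ψ, eq_of_span_singleton_eq_of_isIdempotentElem (he.map (domCongr F F ψ)) hf ?_⟩
  refine SetLike.coe_injective (Eq.trans ?_ hψ)
  ext x
  simp only [Set.mem_image, SetLike.mem_coe, code, Ideal.mem_span_singleton']
  constructor
  · rintro ⟨c, rfl⟩
    refine ⟨_, ⟨(domCongr F F ψ).symm c, rfl⟩, ?_⟩
    rw [map_mul, AlgEquiv.apply_symm_apply]
  · rintro ⟨_, ⟨c, rfl⟩, rfl⟩
    exact ⟨domCongr F F ψ c, (map_mul _ _ _).symm⟩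

theorem GEquivalent.weight_eq {F : Type*} [Field F] {G : Type*} [CommGroup G]
    {I J : Ideal (MonoidAlgebra F G)} (h : GEquivalent I J) : weight I = weight J := by
  have key : ∀ {I J : Ideal (MonoidAlgebra F G)}, GEquivalent I J →
      {n | ∃ x ∈ I, x ≠ 0 ∧ elemWeight x = n} ⊆ {n | ∃ x ∈ J, x ≠ 0 ∧ elemWeight x = n} := by
    rintro I J ⟨ψ, hψ⟩ n ⟨x, hx, hx0, rfl⟩
    refine ⟨domCongr F F ψ x, ?_, ?_, ?_⟩
    · rw [← SetLike.mem_coe, ← hψ]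
      exact ⟨x, hx, rfl⟩
    · rwa [Ne, EmbeddingLike.map_eq_zero_iff]
    · rw [elemWeight, domCongr_support, Finset.card_map, elemWeight]
  rw [weight, weight, (key h).antisymm (key h.symm)]

theorem domCongr_hat {G : Type*} [CommGroup G] [Finite G] (hG : Odd (Nat.card G)) (ψ : G ≃* G)
    (H : Subgroup G) :
    domCongr (ZMod 2) (ZMod 2) ψ (hat (ZMod 2) H) = hat (ZMod 2) (H.map ψ.toMonoidHom) := by
  classical
  ext g
  rw [coeff_domCongr, coeff_hat hG, coeff_hat hG]
  simp only [Subgroup.mem_map_equiv]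

end GEquivalence

/-! ### Automorphisms of `G` and the resulting equivalences -/

section Automorphisms

/-- The homomorphism from the cyclic group of order `n` that sends the generator to `x`. -/
def zmodPowHom {G : Type*} [CommGroup G] {n : ℕ} (x : G) (hx : x ^ n = 1) :
    Multiplicative (ZMod n) →* G :=
  AddMonoidHom.toMultiplicativeLeft
    (ZMod.lift n ⟨zmultiplesHom (Additive G) (Additive.ofMul x), by
      simpa [← ofMul_pow] using hx⟩)

theorem zmodPowHom_one {G : Type*} [CommGroup G] {n : ℕ} (x : G) (hx : x ^ n = 1) :
    zmodPowHom x hx (Multiplicative.ofAdd 1) = x := by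
  have := ZMod.lift_coe n (A := Additive G) ⟨zmultiplesHom (Additive G) (Additive.ofMul x), by
      simpa [← ofMul_pow] using hx⟩ 1
  simp only [Int.cast_one] at this
  simp [zmodPowHom, this]

namespace IsProdSqPrime

variable {p : ℕ} {G : Type*} [CommGroup G] {a b : G} (h : IsProdSqPrime p a b)

include h

/-- The exponent conditions define the map, generation makes it onto, and both sides have `p³`
elements. Two such models compose to an automorphism with prescribed images of `a` and `b`. -/
theorem exists_equiv_model {x y : G} (hx : x ^ (p ^ 2) = 1) (hy : y ^ p = 1)
    (hxy : ∀ S : Subgroup G, x ∈ S → y ∈ S → S = ⊤) :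
    ∃ θ : Multiplicative (ZMod (p ^ 2)) × Multiplicative (ZMod p) ≃* G,
      θ (Multiplicative.ofAdd 1, 1) = x ∧ θ (1, Multiplicative.ofAdd 1) = y := by
  have := Fact.mk h.prime
  have : NeZero (p ^ 2) := ⟨(pow_pos h.prime.pos 2).ne'⟩
  let θ := (zmodPowHom x hx).coprod (zmodPowHom y hy)
  have h1 : θ (Multiplicative.ofAdd 1, 1) = x := by simp [θ, zmodPowHom_one]
  have h2 : θ (1, Multiplicative.ofAdd 1) = y := by simp [θ, zmodPowHom_one]
  have hsurj : Function.Surjective θ := by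
    rw [← MonoidHom.range_eq_top]
    exact hxy _ ⟨_, h1⟩ ⟨_, h2⟩
  have hbij : Function.Bijective θ := by
    refine hsurj.bijective_of_nat_card_le ?_
    rw [Nat.card_prod, Nat.card_congr Multiplicative.toAdd, Nat.card_congr Multiplicative.toAdd,
      Nat.card_zmod, Nat.card_zmod, h.card_eq, ← pow_succ]
  exact ⟨MulEquiv.ofBijective θ hbij, h1, h2⟩

theorem exists_mulEquiv {x y : G} (hx : x ^ (p ^ 2) = 1) (hy : y ^ p = 1)
    (hxy : ∀ S : Subgroup G, x ∈ S → y ∈ S → S = ⊤) : ∃ ψ : G ≃* G, ψ a = x ∧ ψ b = y := by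
  obtain ⟨θ, h1, h2⟩ := h.exists_equiv_model h.pow_left h.pow_right fun _ => h.eq_top_of_mem
  obtain ⟨θ', h1', h2'⟩ := h.exists_equiv_model hx hy hxy
  refine ⟨θ.symm.trans θ', ?_, ?_⟩
  · rw [← h1, MulEquiv.trans_apply, MulEquiv.symm_apply_apply, h1']
  · rw [← h2, MulEquiv.trans_apply, MulEquiv.symm_apply_apply, h2']

theorem gEquivalent_e₁ (j : ℕ) : GEquivalent (code (e₁ p a b 0)) (code (e₁ p a b j)) := by
  have := h.finite
  obtain ⟨ψ, ha, hb⟩ := h.exists_mulEquiv (x := a) (y := a ^ (j * p) * b) h.pow_left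
    (h.pow_mul_pow_prime j)
    fun S hx hy => h.eq_top_of_mem hx ((S.mul_mem_cancel_left (S.pow_mem hx _)).1 hy)
  convert gEquivalent_code_domCongr ψ (e₁ p a b 0) using 2
  -- The automorphism fixing `a` and sending `b` to `a^{jp}b` preserves `⟨a^p⟩ × ⟨b⟩`.
  have hsup : zpowers (a ^ p) ⊔ zpowers b = zpowers (a ^ p) ⊔ zpowers (a ^ (j * p) * b) := by
    have hmem : (a ^ p) ^ j ∈ zpowers (a ^ p) := pow_mem (mem_zpowers _) j
    refine le_antisymm (sup_le le_sup_left ?_) (sup_le le_sup_left (zpowers_pow_mul_le j))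
    rw [zpowers_le, ← mul_mem_cancel_left (mem_sup_left hmem), ← pow_mul, mul_comm p]
    exact mem_sup_right (mem_zpowers _)
  simp only [e₁, map_sub, domCongr_hat h.odd_card, Subgroup.map_sup, MonoidHom.map_zpowers]
  simp only [MulEquiv.toMonoidHom_eq_coe, MonoidHom.coe_coe, map_pow, ha, hb, zero_mul,
    pow_zero, one_mul]
  rw [← hsup]

theorem gEquivalent_e₂ (i : ℕ) : GEquivalent (code (e₂ a b 0)) (code (e₂ a b i)) := by
  have := h.finite
  obtain ⟨ψ, ha, hb⟩ := h.exists_mulEquiv (x := a * b ^ i) (y := b) (h.pow_sq_eq_one _)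
    h.pow_right fun S => h.eq_top_of_mul_mem
  convert gEquivalent_code_domCongr ψ (e₂ a b 0) using 2
  simp only [e₂, map_sub, domCongr_hat h.odd_card, MonoidHom.map_zpowers,
    Subgroup.map_top_of_surjective ψ.toMonoidHom ψ.surjective]
  simp only [MulEquiv.toMonoidHom_eq_coe, MonoidHom.coe_coe, ha, pow_zero, mul_one]

/-- Dimension and weight agree here, so the group structure must decide: `Ĝ` is fixed, hence `⟨a⟩`
would map onto `⟨a^p⟩ × ⟨b⟩`, whose elements have trivial `p`-th power. -/
theorem not_gEquivalent_e₂_e₃ : ¬ GEquivalent (code (e₂ a b 0)) (code (e₃ p a b)) := by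
  have := h.finite
  intro hE
  obtain ⟨ψ, hψ⟩ := hE.exists_domCongr_eq (isIdempotentElem_hat_sub_hat h.odd_card le_top)
    (isIdempotentElem_hat_sub_hat h.odd_card le_top)
  rw [map_sub, domCongr_hat h.odd_card, domCongr_hat h.odd_card,
    Subgroup.map_top_of_surjective ψ.toMonoidHom ψ.surjective, sub_left_inj] at hψ
  have hmap := hat_injective h.odd_card hψ
  have hmem : ψ a ∈ zpowers (a ^ p) ⊔ zpowers b := by
    rw [← hmap]
    refine ⟨a, ?_, rfl⟩
    rw [pow_zero, mul_one]
    exact mem_zpowers a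
  have := h.pow_eq_one_of_mem hmem
  rw [← map_pow, EmbeddingLike.map_eq_one_iff] at this
  exact h.pow_left_ne_one this

end IsProdSqPrime

end Automorphisms

/-! ### The four classes and the failure of Miller's assertion -/

section Classes

variable {p : ℕ} {G : Type*} [CommGroup G] {a b : G}

theorem rep_one : rep p a b 1 = e₁ p a b 0 := by
  simp [rep, e₁]

theorem rep_two : rep p a b 2 = e₂ a b 0 := by
  simp [rep, e₂]

namespace IsProdSqPrime

variable (h : IsProdSqPrime p a b)

include h

theorem rep_eq_primIdem (k : Fin 4) : ∃ l, rep p a b k = primIdem p a b l := by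
  fin_cases k
  · exact ⟨Sum.inl 0, rfl⟩
  · exact ⟨Sum.inr (Sum.inl ⟨0, h.prime.pos⟩), rep_one⟩
  · exact ⟨Sum.inr (Sum.inr ⟨0, h.prime.pos⟩), rep_two⟩
  · exact ⟨Sum.inl 1, rfl⟩

theorem isMinimalCode_rep (k : Fin 4) : IsMinimalCode (code (rep p a b k)) := by
  obtain ⟨l, hl⟩ := h.rep_eq_primIdem k
  exact (h.isMinimalCode_iff _).2 ⟨l, by rw [hl]⟩

theorem exists_rep_gEquivalent {I : Ideal (MonoidAlgebra (ZMod 2) G)} (hI : IsMinimalCode I) :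
    ∃ k, GEquivalent (code (rep p a b k)) I := by
  obtain ⟨k | j | i, rfl⟩ := (h.isMinimalCode_iff I).1 hI
  · fin_cases k
    · exact ⟨0, GEquivalent.refl _⟩
    · exact ⟨3, GEquivalent.refl _⟩
  · exact ⟨1, rep_one (p := p) (a := a) (b := b) ▸ h.gEquivalent_e₁ j⟩
  · exact ⟨2, rep_two (p := p) (a := a) (b := b) ▸ h.gEquivalent_e₂ i⟩

theorem not_gEquivalent_rep_of_lt {k l : Fin 4} (hkl : k < l) :
    ¬ GEquivalent (code (rep p a b k)) (code (rep p a b l)) := by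
  have hp := h.prime.one_lt
  obtain ⟨m, hm⟩ := h.odd
  have hodd : Odd (p ^ 3) := h.odd.pow
  have h01 : p ^ 3 ≠ 2 * p := fun he => by
    rw [he] at hodd
    exact Nat.not_odd_iff_even.2 (even_two_mul _) hodd
  have h02 : p ^ 3 ≠ 2 * p ^ 2 := fun he => by
    rw [he] at hodd
    exact Nat.not_odd_iff_even.2 (even_two_mul _) hodd
  have h12 : 2 * p ≠ 2 * p ^ 2 := by nlinarith
  have w0 : weight (code (rep p a b 0)) = p ^ 3 := h.weight_e₀
  have w1 : weight (code (rep p a b 1)) = 2 * p := by rw [rep_one, h.weight_e₁]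
  have w2 : weight (code (rep p a b 2)) = 2 * p ^ 2 := by rw [rep_two, h.weight_e₂]
  have w3 : weight (code (rep p a b 3)) = 2 * p ^ 2 := h.weight_e₃
  intro hE
  have hw := hE.weight_eq
  -- Of the six pairs, parity of the weight separates `Ĝ` from the rest and size separates `2p` from
  -- `2p²`; only the last pair has equal weights.
  fin_cases k <;> fin_cases l <;> first | exact absurd hkl (by decide) | skip
  · exact h01 (w0.symm.trans (hw.trans w1))
  · exact h02 (w0.symm.trans (hw.trans w2))
  · exact h02 (w0.symm.trans (hw.trans w3))
  · exact h12 (w1.symm.trans (hw.trans w2))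
  · exact h12 (w1.symm.trans (hw.trans w3))
  · refine h.not_gEquivalent_e₂_e₃ ?_
    rw [← rep_two (p := p)]
    exact hE

theorem not_gEquivalent_rep {k l : Fin 4} (hkl : k ≠ l) :
    ¬ GEquivalent (code (rep p a b k)) (code (rep p a b l)) := by
  rcases hkl.lt_or_gt with hlt | hlt
  · exact h.not_gEquivalent_rep_of_lt hlt
  · exact fun hE => h.not_gEquivalent_rep_of_lt hlt hE.symm

theorem numMinimalClasses_eq : numMinimalClasses (ZMod 2) G = 4 := by
  let q : Fin 4 → Quotient (minimalCodeSetoid (ZMod 2) G) := fun k =>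
    Quotient.mk _ ⟨code (rep p a b k), h.isMinimalCode_rep k⟩
  have hq : Function.Bijective q := by
    constructor
    · intro k l hkl
      by_contra hne
      exact h.not_gEquivalent_rep hne (Quotient.exact hkl)
    · intro x
      obtain ⟨⟨I, hI⟩, rfl⟩ := Quotient.exists_rep x
      obtain ⟨k, hk⟩ := h.exists_rep_gEquivalent hI
      exact ⟨k, Quotient.sound hk⟩
  rw [numMinimalClasses, ← Nat.card_congr (Equiv.ofBijective q hq), Nat.card_eq_fintype_card,
    Fintype.card_fin]

theorem card_divisors : (p ^ 2).divisors.card = 3 := by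
  rw [Nat.divisors_prime_pow h.prime, Finset.card_map, Finset.card_range]

theorem not_millerClaim : ¬ MillerClaim G := by
  intro hM
  have := hM h.odd_card
  rw [h.numMinimalClasses_eq, h.exponent_eq, h.card_divisors] at this
  exact absurd this (by norm_num)

theorem isMinimalCode_iff_listed (I : Ideal (MonoidAlgebra (ZMod 2) G)) :
    IsMinimalCode I ↔ (I = code (e₀ G) ∨ (∃ j < p, I = code (e₁ p a b j)) ∨
      (∃ i < p, I = code (e₂ a b i)) ∨ I = code (e₃ p a b)) := by
  rw [h.isMinimalCode_iff]
  constructor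
  · rintro ⟨k | j | i, rfl⟩
    · fin_cases k
      · exact Or.inl rfl
      · exact Or.inr (Or.inr (Or.inr rfl))
    · exact Or.inr (Or.inl ⟨j, j.2, rfl⟩)
    · exact Or.inr (Or.inr (Or.inl ⟨i, i.2, rfl⟩))
  · rintro (rfl | ⟨j, hj, rfl⟩ | ⟨i, hi, rfl⟩ | rfl)
    · exact ⟨Sum.inl 0, rfl⟩
    · exact ⟨Sum.inr (Sum.inl ⟨j, hj⟩), rfl⟩
    · exact ⟨Sum.inr (Sum.inr ⟨i, hi⟩), rfl⟩
    · exact ⟨Sum.inl 1, rfl⟩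

end IsProdSqPrime

/-- The general result is conditional on a suitable `p`; the case `p = 3` supplies an actual
counterexample. -/
theorem isProdSqPrime_three :
    IsProdSqPrime 3 (G := Multiplicative (ZMod (3 ^ 2)) × Multiplicative (ZMod 3))
      (Multiplicative.ofAdd 1, 1) (1, Multiplicative.ofAdd 1) where
  prime := Nat.prime_three
  odd := by decide
  two_generates := by
    refine ⟨ZMod.unitOfCoprime 2 (by decide), rfl, ?_⟩
    rw [eq_top_iff]
    intro x _
    -- The class of 2 has order 6 = φ(9), so exponents below 6 suffice for a finite check.
    have : ∀ x : (ZMod 9)ˣ, ∃ k < 6,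
        (ZMod.unitOfCoprime 2 (by decide : Nat.Coprime 2 9)) ^ k = x := by decide
    obtain ⟨k, -, h⟩ := this x
    exact ⟨k, by simpa using h⟩
  orderOf_left := by
    rw [Prod.orderOf_mk, orderOf_one, orderOf_ofAdd_eq_addOrderOf, ZMod.addOrderOf_one,
      Nat.lcm_one_right]
  orderOf_right := by
    rw [Prod.orderOf_mk, orderOf_one, orderOf_ofAdd_eq_addOrderOf, ZMod.addOrderOf_one,
      Nat.lcm_one_left]
  isCompl := by
    constructor
    · rw [Subgroup.disjoint_def]
      rintro _ ⟨m, rfl⟩ ⟨n, hn⟩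
      have h1 := congrArg Prod.fst hn
      exact Prod.ext (h1.symm.trans (by simp)) (by simp)
    · rw [codisjoint_iff, eq_top_iff]
      rintro ⟨x, y⟩ -
      refine Subgroup.mem_sup.2 ⟨(x, 1), ⟨(x.toAdd.val : ℤ), ?_⟩, (1, y),
        ⟨(y.toAdd.val : ℤ), ?_⟩, by simp⟩
      · ext
        · simp
        · simp
      · ext
        · simp
        · simp

end Classes

end AbelianCode

end

theorem mainTheorem6 :
    (∀ (p : ℕ), p.Prime → Odd p →
      (∃ u : (ZMod (p ^ 2))ˣ, (u : ZMod (p ^ 2)) = 2 ∧ Subgroup.zpowers u = ⊤) →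
      ∀ (G : Type*) [CommGroup G] (a b : G),
        orderOf a = p ^ 2 → orderOf b = p →
        IsCompl (Subgroup.zpowers a) (Subgroup.zpowers b) →
        -- exactly four classes of minimal codes, with the four listed representatives
        ((∀ k : Fin 4, AbelianCode.IsMinimalCode
            (AbelianCode.code (AbelianCode.rep p a b k))) ∧
          (∀ k l : Fin 4, k ≠ l → ¬ AbelianCode.GEquivalent
            (AbelianCode.code (AbelianCode.rep p a b k))
            (AbelianCode.code (AbelianCode.rep p a b l))) ∧
          (∀ I : Ideal (MonoidAlgebra (ZMod 2) G), AbelianCode.IsMinimalCode I →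
            ∃ k : Fin 4, AbelianCode.GEquivalent
              (AbelianCode.code (AbelianCode.rep p a b k)) I) ∧
          AbelianCode.numMinimalClasses (ZMod 2) G = 4) ∧
        -- the list of all minimal codes, without repetitions
        ((∀ I : Ideal (MonoidAlgebra (ZMod 2) G), AbelianCode.IsMinimalCode I ↔
            (I = AbelianCode.code (AbelianCode.e₀ G) ∨
              (∃ j < p, I = AbelianCode.code (AbelianCode.e₁ p a b j)) ∨
              (∃ i < p, I = AbelianCode.code (AbelianCode.e₂ a b i)) ∨
              I = AbelianCode.code (AbelianCode.e₃ p a b))) ∧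
          {I : Ideal (MonoidAlgebra (ZMod 2) G) | AbelianCode.IsMinimalCode I}.ncard
            = 2 * p + 2) ∧
        -- the generators are primitive idempotents; dimensions and weights
        (AbelianCode.IsPrimitiveIdempotent (AbelianCode.e₀ G) ∧
          AbelianCode.dim (AbelianCode.code (AbelianCode.e₀ G)) = 1 ∧
          AbelianCode.weight (AbelianCode.code (AbelianCode.e₀ G)) = p ^ 3) ∧
        (∀ j < p,
          AbelianCode.IsPrimitiveIdempotent (AbelianCode.e₁ p a b j) ∧
          AbelianCode.dim (AbelianCode.code (AbelianCode.e₁ p a b j)) = p ^ 2 - p ∧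
          AbelianCode.weight (AbelianCode.code (AbelianCode.e₁ p a b j)) = 2 * p) ∧
        (∀ i < p,
          AbelianCode.IsPrimitiveIdempotent (AbelianCode.e₂ a b i) ∧
          AbelianCode.dim (AbelianCode.code (AbelianCode.e₂ a b i)) = p - 1 ∧
          AbelianCode.weight (AbelianCode.code (AbelianCode.e₂ a b i)) = 2 * p ^ 2) ∧
        (AbelianCode.IsPrimitiveIdempotent (AbelianCode.e₃ p a b) ∧
          AbelianCode.dim (AbelianCode.code (AbelianCode.e₃ p a b)) = p - 1 ∧
          AbelianCode.weight (AbelianCode.code (AbelianCode.e₃ p a b)) = 2 * p ^ 2) ∧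
        -- the group violates Miller's assertion
        (Finite G ∧ Odd (Nat.card G) ∧ Monoid.exponent G = p ^ 2 ∧
          (p ^ 2).divisors.card = 3 ∧ ¬ AbelianCode.MillerClaim G)) ∧
    -- hence Miller's assertion is not true of all finite abelian groups
    ¬ ∀ (G : Type) [CommGroup G] [Finite G], AbelianCode.MillerClaim G := by
  refine ⟨?_, fun hM => AbelianCode.isProdSqPrime_three.not_millerClaim (hM _)⟩
  intro p hp hodd h2 G _ a b ha hb hab
  have h : AbelianCode.IsProdSqPrime p a b := ⟨hp, hodd, h2, ha, hb, hab⟩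
  exact ⟨⟨h.isMinimalCode_rep, fun _ _ => h.not_gEquivalent_rep,
      fun _ => h.exists_rep_gEquivalent, h.numMinimalClasses_eq⟩,
    ⟨h.isMinimalCode_iff_listed, h.ncard_isMinimalCode⟩,
    ⟨h.isPrimitiveIdempotent_primIdem (Sum.inl 0), h.dim_e₀, h.weight_e₀⟩,
    fun j hj => ⟨h.isPrimitiveIdempotent_primIdem (Sum.inr (Sum.inl ⟨j, hj⟩)), h.dim_e₁ j,
      h.weight_e₁ j⟩,
    fun i hi => ⟨h.isPrimitiveIdempotent_primIdem (Sum.inr (Sum.inr ⟨i, hi⟩)), h.dim_e₂ i,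
      h.weight_e₂ i⟩,
    ⟨h.isPrimitiveIdempotent_primIdem (Sum.inl 1), h.dim_e₃, h.weight_e₃⟩,
    ⟨h.finite, h.odd_card, h.exponent_eq, h.card_divisors, h.not_millerClaim⟩⟩
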